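/- Let $\mathcal X$ be a measurable space, let $k\ge 1$, and let $\mathcal D_T$ and $\mathcal D_{S_1},\dots,\mathcal D_{S_k}$ be probability distributions on $\mathcal X$ (the target and the $k$ sources). Let $\mathcal H$ be a class of measurable functions $h:\mathcal X\to\{0,1\}$ with VC dimension $d$, that is, $d=\max\{n:\Pi_{\mathcal H}(n)=2^n\}$, where $\Pi_{\mathcal H}(n)$ is the largest number of labellings $(h(x_1),\dots,h(x_n))$, $h\in\mathcal H$, of $n$ distinct points of $\mathcal X$. Put $\mathcal A_{\mathcal H}=\{h^{-1}(\{1\}):h\in\mathcal H\}$ and, for probability measures $P,Q_1,\dots,Q_k$ on $\mathcal X$, $$d_{\mathcal H}(P;\{Q_i\}_{i=1}^k)=\max_{1\le i\le k}\,2\sup_{A\in\mathcal A_{\mathcal H}}|P(A)-Q_i(A)| .$$ Assume that $\mathcal H$ is a measurable class in the usual sense of empirical process theory: for all $n$, all $P_1,\dots,P_n\in\{\mathcal D_T,\mathcal D_{S_1},\dots,\mathcal D_{S_k}\}$ and all $c\in\mathbb R^n$, the function $(z_1,\dots,z_n)\mapsto\sup_{h\in\mathcal H}\bigl|\sum_j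 c_jh(z_j)\bigr|$ is measurable for the completion of $P_1\otimes\cdots\otimes P_n$ (this is automatic if $\mathcal H$ is countable). Let $m\ge 1$ with $m\ge d$, and let $\widehat{\mathcal D}_T$ and $\widehat{\mathcal D}_{S_1},\dots,\widehat{\mathcal D}_{S_k}$ be the empirical distributions of $m$ i.i.d. samples from each of $\mathcal D_T,\mathcal D_{S_1},\dots,\mathcal D_{S_k}$, all $(k+1)m$ sample points being independent. Then, for every $0<\delta<1$, with probability at least $1-\delta$ over the choice of the samples, $$\left|d_{\mathcal H}(\mathcal D_T;\{\mathcal D_{S_i}\}_{i=1}^k)-d_{\mathcal H}(\widehat{\mathcal D}_T;\{\widehat{\mathcal D}_{S_i}\}_{i=1}^k)\right|\le 2\sqrt{\frac2m\left(\log\frac{4k}{\delta}+d\log\frac{em}{d}\right)},$$ where $d\log(em/d)$ is read as $0$ when $d=0$. (In particular, the event in question is measurable for the completed probability.) -/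

import Mathlib

open MeasureTheory ProbabilityTheory
open scoped ENNReal

noncomputable section

/-- The collection `{h⁻¹({1}) | h ∈ H}` of the sets cut out by a class of binary hypotheses. -/
def hypothesisSets {X : Type*} (H : Set (X → Bool)) : Set (Set X) :=
  (fun h : X → Bool => h ⁻¹' {true}) '' H

/-- The growth function: the largest number of labellings that `H` induces on a set of
`n` distinct points (with value `0` if there are fewer than `n` points). -/
def growthFunction {X : Type*} (H : Set (X → Bool)) (n : ℕ) : ℕ :=
  ⨆ S : {S : Finset X // S.card = n},
    Set.ncard ((fun (h : X → Bool) (x : {x // x ∈ S.1}) => h x) '' H)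

/-- `VCdim(H) = d`, where `VCdim(H) = max {n | growthFunction H n = 2 ^ n}`. -/
def HasVCDim {X : Type*} (H : Set (X → Bool)) (d : ℕ) : Prop :=
  IsGreatest {n : ℕ | growthFunction H n = 2 ^ n} d

/-- The `H`-divergence `2 sup_A |P(A) - Q(A)|` between two distributions. -/
def hDivergence {X : Type*} [MeasurableSpace X] (H : Set (X → Bool)) (P Q : Measure X) : ℝ :=
  2 * ⨆ A : hypothesisSets H, |P.real (A : Set X) - Q.real (A : Set X)|

/-- The multi-source `H`-divergence `max_i d_H(P, Q_i)` (the maximum is over a finite set, and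
is used for `0 < k` only). -/
def multiHDivergence {X : Type*} [MeasurableSpace X] (H : Set (X → Bool)) {k : ℕ}
    (P : Measure X) (Q : Fin k → Measure X) : ℝ :=
  ⨆ i : Fin k, hDivergence H P (Q i)

/-- The empirical distribution, with mass `1 / m` at each of the `m` sample points. -/
def empiricalMeasure {X : Type*} [MeasurableSpace X] {m : ℕ} (x : Fin m → X) : Measure X :=
  (m : ℝ≥0∞)⁻¹ • ∑ j : Fin m, Measure.dirac (x j)

/-- The usual regularity condition of empirical process theory (a "measurable class" with respect
to a family `D` of distributions): for independent points `z₁, …, zₙ` with laws in `D` and real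
weights `c₁, …, cₙ`, the supremum over `h ∈ H` of `|∑ cⱼ h(zⱼ)|` is measurable with respect to the
completion of the joint law. Every countable class of measurable hypotheses has it. -/
def IsMeasurableClass {X : Type*} [MeasurableSpace X] (H : Set (X → Bool))
    (D : Set (Measure X)) : Prop :=
  ∀ (n : ℕ) (P : Fin n → Measure X), (∀ j, P j ∈ D) → ∀ c : Fin n → ℝ,
    AEMeasurable
      (fun z : Fin n → X => ⨆ h : H, |∑ j, c j * (if (h : X → Bool) (z j) = true then 1 else 0)|)
      (Measure.pi P)

end

/-!
A union bound over the sources reduces to one source. There, up to the factor `2 / m`, the empirical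
divergence is the supremum over `H` of the absolute values of signed sums over `2 * m` independent
points, with `m` signs `1` and `m` signs `-1`, and the divergence is the supremum of the absolute
values of their means.

For the upper tail, every sample point is accompanied by `11` ghost points of the same law. The
joint law is invariant under exchanging points within each block of `12`, so that, given all
`24 * m` points, the observed point of each block is uniformly distributed in it, and a union
bound over the at most `(24 * e * m / d) ^ d` labellings suffices. Writing `m * t` for the
deviation of the signed sum, the observed point and the block average are tilted in opposite
directions so as to obtain the exact Chernoff rate `2 * m * KL(t, t / 12)`, where `KL(t, s)` is the
divergence between the laws on `{-1, 1}` with means `t` and `s`. Its excess over `m * t ^ 2 / 2`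
pays for the `d * log 24` by which the labellings exceed `(e * m / d) ^ d`; this is where the
number `11` comes from. With a single ghost point per sample point there is no such excess.

The lower tail needs no uniformity over `H`: it is Hoeffding's inequality for one near-maximal
hypothesis.
-/

section Sauer

variable {X : Type*} {H : Set (X → Bool)}

theorem ncard_restrict_image_le (H : Set (X → Bool)) (S : Finset X) :
    Set.ncard ((fun (h : X → Bool) (x : {x // x ∈ S}) => h x) '' H) ≤ 2 ^ S.card := by
  refine (Set.ncard_le_ncard (Set.subset_univ _)).trans_eq ?_
  simp [Set.ncard_univ, Nat.card_fun]

theorem growthFunction_le_two_pow (H : Set (X → Bool)) (n : ℕ) : growthFunction H n ≤ 2 ^ n :=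
  ciSup_le' fun S => (ncard_restrict_image_le H S.1).trans_eq (by rw [S.2])

theorem growthFunction_card_eq_two_pow {S : Finset X}
    (hS : ∀ q : {x // x ∈ S} → Bool, ∃ h ∈ H, ∀ x : {x // x ∈ S}, h x = q x) :
    growthFunction H S.card = 2 ^ S.card := by
  refine le_antisymm (growthFunction_le_two_pow H _) ?_
  have hbdd : BddAbove (Set.range fun T : {T : Finset X // T.card = S.card} =>
      Set.ncard ((fun (h : X → Bool) (x : {x // x ∈ T.1}) => h x) '' H)) :=
    ⟨2 ^ S.card, by
      rintro _ ⟨T, rfl⟩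
      exact (ncard_restrict_image_le H T.1).trans_eq (by rw [T.2])⟩
  refine le_trans ?_ (le_ciSup hbdd ⟨S, rfl⟩)
  have huniv : (fun (h : X → Bool) (x : {x // x ∈ S}) => h x) '' H = Set.univ :=
    Set.eq_univ_of_forall fun q => (hS q).imp fun h hh => ⟨hh.1, funext hh.2⟩
  simp [huniv, Set.ncard_univ, Nat.card_fun]

theorem HasVCDim.nonempty {d : ℕ} (hVC : HasVCDim H d) : H.Nonempty := by
  rw [Set.nonempty_iff_ne_empty]
  rintro rfl
  have hd : growthFunction (∅ : Set (X → Bool)) d = 2 ^ d := hVC.1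
  have h0 : growthFunction (∅ : Set (X → Bool)) d = 0 :=
    Nat.le_zero.1 (ciSup_le' fun S => by simp)
  exact pow_ne_zero d two_ne_zero (hd.symm.trans h0)

section Traces

variable {ι : Type*} [Fintype ι]

/-- The labellings `(h (z i))ᵢ` of a finite family of points by the hypotheses `h ∈ H`. -/
noncomputable def labellings (H : Set (X → Bool)) (z : ι → X) : Finset (ι → Bool) :=
  (Set.toFinite ((fun (h : X → Bool) i => h (z i)) '' H)).toFinset

theorem mem_labellings {z : ι → X} {p : ι → Bool} :
    p ∈ labellings H z ↔ ∃ h ∈ H, (fun i => h (z i)) = p := by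
  simp [labellings]

/-- The subsets of the index set of a family of points that `H` picks out: the family of sets
corresponding to `labellings H z`, to which the Sauer–Shelah lemma applies. -/
noncomputable def labelTraces [DecidableEq ι] (H : Set (X → Bool)) (z : ι → X) :
    Finset (Finset ι) :=
  (labellings H z).image fun p => Finset.univ.filter fun i => p i = true

variable [DecidableEq ι]

theorem mem_labelTraces {z : ι → X} {s : Finset ι} :
    s ∈ labelTraces H z ↔ ∃ h ∈ H, ∀ i, i ∈ s ↔ h (z i) = true := by
  simp only [labelTraces, Finset.mem_image, mem_labellings]
  constructor
  · rintro ⟨_, ⟨h, hh, rfl⟩, rfl⟩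
    exact ⟨h, hh, by simp⟩
  · rintro ⟨h, hh, hs⟩
    exact ⟨_, ⟨h, hh, rfl⟩, by ext i; simp [hs]⟩

theorem card_labelTraces (H : Set (X → Bool)) (z : ι → X) :
    (labelTraces H z).card = (labellings H z).card := by
  refine Finset.card_image_of_injective _ fun p q hpq => funext fun i => Bool.eq_iff_iff.2 ?_
  simpa using Finset.ext_iff.1 hpq i

theorem injOn_of_shatters_labelTraces {z : ι → X} {T : Finset ι}
    (hT : (labelTraces H z).Shatters T) : Set.InjOn z T := by
  intro i hi j hj hij
  obtain ⟨s, hs, hTs⟩ := hT.exists_inter_eq_singleton hi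
  obtain ⟨h, -, hh⟩ := mem_labelTraces.1 hs
  have his : i ∈ s := (Finset.mem_inter.1 (hTs ▸ Finset.mem_singleton_self i)).2
  have hjs : j ∈ s := (hh j).2 (hij ▸ (hh i).1 his)
  exact (Finset.mem_singleton.1 (hTs ▸ Finset.mem_inter.2 ⟨hj, hjs⟩)).symm

theorem HasVCDim.card_le_of_shatters {d : ℕ} (hVC : HasVCDim H d) {z : ι → X} {T : Finset ι}
    (hT : (labelTraces H z).Shatters T) : T.card ≤ d := by
  classical
  rw [← Finset.card_image_of_injOn (injOn_of_shatters_labelTraces hT)]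
  refine hVC.2 (growthFunction_card_eq_two_pow fun q => ?_)
  obtain ⟨s, hs, hTs⟩ :=
    hT (Finset.filter_subset (fun i => ∃ hi : z i ∈ T.image z, q ⟨z i, hi⟩ = true) T)
  obtain ⟨h, hH, hh⟩ := mem_labelTraces.1 hs
  refine ⟨h, hH, fun ⟨x, hx⟩ => Bool.eq_iff_iff.2 ?_⟩
  obtain ⟨i, hi, rfl⟩ := Finset.mem_image.1 hx
  have hmem := Finset.ext_iff.1 hTs i
  simp only [Finset.mem_inter, Finset.mem_filter, hi, true_and, hh i] at hmem
  exact hmem.trans ⟨fun ⟨_, hq⟩ => hq, fun hq => ⟨hx, hq⟩⟩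

end Traces

theorem HasVCDim.card_labellings_le {ι : Type*} [Fintype ι] {d : ℕ} (hVC : HasVCDim H d)
    (z : ι → X) : (labellings H z).card ≤ ∑ i ∈ Finset.Iic d, (Fintype.card ι).choose i := by
  classical
  rw [← card_labelTraces]
  refine (labelTraces H z).card_le_card_shatterer.trans
    (Finset.card_shatterer_le_sum_vcDim.trans
      (Finset.sum_le_sum_of_subset (Finset.Iic_subset_Iic.2 ?_)))
  exact Finset.sup_le fun T hT => hVC.card_le_of_shatters (Finset.mem_shatterer.1 hT)

end Sauer

theorem sum_choose_le_exp {n d : ℕ} (hdn : d ≤ n) :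
    ((∑ i ∈ Finset.Iic d, n.choose i : ℕ) : ℝ) ≤ Real.exp (d * Real.log (Real.exp 1 * n / d)) := by
  rcases Nat.eq_zero_or_pos d with rfl | hd
  · simp [show Finset.Iic 0 = {0} from rfl]
  have hd0 : (0 : ℝ) < d := mod_cast hd
  have hn0 : (0 : ℝ) < n := mod_cast hd.trans_le hdn
  set x : ℝ := d / n
  have hx0 : 0 < x := div_pos hd0 hn0
  have hx1 : x ≤ 1 := (div_le_one hn0).2 (mod_cast hdn)
  have hbinom : ((∑ i ∈ Finset.Iic d, n.choose i : ℕ) : ℝ) * x ^ d ≤ Real.exp d := by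
    calc ((∑ i ∈ Finset.Iic d, n.choose i : ℕ) : ℝ) * x ^ d
        ≤ ∑ i ∈ Finset.Iic d, x ^ i * (n.choose i : ℝ) := by
          push_cast
          rw [Finset.sum_mul]
          refine Finset.sum_le_sum fun i hi => ?_
          rw [mul_comm]
          exact mul_le_mul_of_nonneg_right
            (pow_le_pow_of_le_one hx0.le hx1 (Finset.mem_Iic.1 hi)) (Nat.cast_nonneg _)
      _ ≤ ∑ i ∈ Finset.range (n + 1), x ^ i * (n.choose i : ℝ) := by
          refine Finset.sum_le_sum_of_subset_of_nonneg (fun i hi => ?_) fun i _ _ => by positivity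
          exact Finset.mem_range.2 (by have := Finset.mem_Iic.1 hi; omega)
      _ = (x + 1) ^ n := by simp [add_pow]
      _ ≤ Real.exp x ^ n := by gcongr; exact Real.add_one_le_exp _
      _ = Real.exp d := by
          rw [← Real.exp_nat_mul, mul_div_cancel₀ _ hn0.ne']
  have hexp : Real.exp (d * Real.log (Real.exp 1 * n / d)) = Real.exp d / x ^ d := by
    rw [Real.exp_nat_mul, Real.exp_log (by positivity), ← Real.exp_one_pow, ← div_pow,
      div_div_eq_mul_div]
  rw [hexp]
  exact (le_div_iff₀ (by positivity)).2 hbinom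

section Tilt

/-- The Kullback–Leibler divergence between the laws on `{-1, 1}` with means `t` and `s`. -/
noncomputable def signKL (t s : ℝ) : ℝ :=
  ((1 + t) * Real.log ((1 + t) / (1 + s)) + (1 - t) * Real.log ((1 - t) / (1 - s))) / 2

/-- The exponential tilt of the marked point of a block: it moves the mean of a sign from `s`
to `t`. -/
noncomputable def markTilt (t s : ℝ) : ℝ := Real.artanh t - Real.artanh s

/-- The compensating tilt of the average of a block. -/
noncomputable def blockTilt (t s : ℝ) : ℝ := (t - s) / (1 - s ^ 2)

/-- The bound on the moment generating function of a block under the two tilts. -/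
noncomputable def tiltBound (t s : ℝ) : ℝ :=
  √((1 - s ^ 2) / (1 - t ^ 2)) * Real.exp (-(blockTilt t s * s))

variable {s t : ℝ}

-- The left-hand side is affine in `u`; it is the tangent at `u = s` of the right-hand side.
theorem cosh_markTilt_add_mul_sinh_le (hs : s ∈ Set.Ioo (-1) 1) (ht : t ∈ Set.Ioo (-1) 1) (u : ℝ) :
    Real.cosh (markTilt t s) + u * Real.sinh (markTilt t s) ≤
      tiltBound t s * Real.exp (blockTilt t s * u) := by
  have hs2 : 0 < 1 - s ^ 2 := by nlinarith [hs.1, hs.2]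
  have ht2 : 0 < 1 - t ^ 2 := by nlinarith [ht.1, ht.2]
  have hexp : blockTilt t s * (u - s) + 1 ≤ Real.exp (blockTilt t s * (u - s)) :=
    Real.add_one_le_exp _
  have hsq : √(1 - s ^ 2) ^ 2 = 1 - s ^ 2 := Real.sq_sqrt hs2.le
  have hs0 : 0 < √(1 - s ^ 2) := Real.sqrt_pos.2 hs2
  have ht0 : 0 < √(1 - t ^ 2) := Real.sqrt_pos.2 ht2
  calc Real.cosh (markTilt t s) + u * Real.sinh (markTilt t s)
      = √((1 - s ^ 2) / (1 - t ^ 2)) * (blockTilt t s * (u - s) + 1) := by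
        rw [markTilt, Real.cosh_sub, Real.sinh_sub, Real.cosh_artanh ht, Real.sinh_artanh ht,
          Real.cosh_artanh hs, Real.sinh_artanh hs, Real.sqrt_div hs2.le, blockTilt]
        field_simp [hs0.ne', ht0.ne']
        linear_combination -(1 - s * t - s * u + t * u) * hsq
    _ ≤ √((1 - s ^ 2) / (1 - t ^ 2)) * Real.exp (blockTilt t s * (u - s)) := by gcongr
    _ = tiltBound t s * Real.exp (blockTilt t s * u) := by
        rw [tiltBound, mul_assoc, ← Real.exp_add]
        ring_nf

theorem tanh_le_self {a : ℝ} (ha : 0 ≤ a) : Real.tanh a ≤ a := by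
  have hlog := Real.le_log_one_add_of_nonneg (x := Real.exp (2 * a) - 1)
    (sub_nonneg.2 (Real.one_le_exp (by positivity)))
  rw [add_sub_cancel, Real.log_exp] at hlog
  have htanh : Real.tanh a = (Real.exp (2 * a) - 1) / (Real.exp (2 * a) + 1) := by
    rw [Real.tanh_eq, two_mul, Real.exp_add, Real.exp_neg]
    field_simp
  rw [show Real.exp (2 * a) - 1 + 2 = Real.exp (2 * a) + 1 by ring, mul_div_assoc, ← htanh] at hlog
  linarith

theorem blockTilt_nonneg (hs0 : 0 ≤ s) (hst : s ≤ t) (ht : t < 1) : 0 ≤ blockTilt t s :=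
  div_nonneg (by linarith) (by nlinarith)

theorem blockTilt_le_markTilt (hs0 : 0 ≤ s) (hst : s ≤ t) (ht : t < 1) :
    blockTilt t s ≤ markTilt t s := by
  have hs' : s ∈ Set.Ioo (-1) 1 := ⟨by linarith, by linarith⟩
  have ht' : t ∈ Set.Ioo (-1) 1 := ⟨by linarith, ht⟩
  have hmark : 0 ≤ markTilt t s := sub_nonneg.2 (Real.artanh_le_artanh hs'.1 ht hst)
  have hst2 : 0 < 1 - t * s := by nlinarith
  have htanh : Real.tanh (markTilt t s) = (t - s) / (1 - t * s) := by
    have hs2 : 0 < √(1 - s ^ 2) := Real.sqrt_pos.2 (by nlinarith)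
    have ht2 : 0 < √(1 - t ^ 2) := Real.sqrt_pos.2 (by nlinarith)
    rw [Real.tanh_eq_sinh_div_cosh, markTilt, Real.cosh_sub, Real.sinh_sub, Real.cosh_artanh ht',
      Real.sinh_artanh ht', Real.cosh_artanh hs', Real.sinh_artanh hs']
    field_simp
  calc blockTilt t s ≤ (t - s) / (1 - t * s) :=
        div_le_div_of_nonneg_left (by linarith) hst2 (by nlinarith)
    _ ≤ markTilt t s := htanh ▸ tanh_le_self hmark

theorem tiltBound_mul_exp (hs : s ∈ Set.Ioo (-1) 1) (ht : t ∈ Set.Ioo (-1) 1) :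
    tiltBound t s * Real.exp (-(markTilt t s * t - blockTilt t s * s)) =
      Real.exp (-signKL t s) := by
  have h1s : 0 < 1 + s := by linarith [hs.1]
  have h1s' : 0 < 1 - s := by linarith [hs.2]
  have h1t : 0 < 1 + t := by linarith [ht.1]
  have h1t' : 0 < 1 - t := by linarith [ht.2]
  have hsqrt : √((1 - s ^ 2) / (1 - t ^ 2)) = Real.exp
      ((Real.log (1 + s) + Real.log (1 - s) - Real.log (1 + t) - Real.log (1 - t)) / 2) := by
    rw [Real.exp_half, ← Real.log_mul h1s.ne' h1s'.ne', sub_sub, ← Real.log_mul h1t.ne' h1t'.ne',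
      ← Real.log_div (by positivity) (by positivity), Real.exp_log (by positivity)]
    ring_nf
  have hmark : markTilt t s =
      (Real.log (1 + t) - Real.log (1 - t) - Real.log (1 + s) + Real.log (1 - s)) / 2 := by
    rw [markTilt, Real.artanh_eq_half_log (Set.Ioo_subset_Icc_self ht),
      Real.artanh_eq_half_log (Set.Ioo_subset_Icc_self hs), Real.log_div h1t.ne' h1t'.ne',
      Real.log_div h1s.ne' h1s'.ne']
    ring
  rw [tiltBound, hsqrt, mul_assoc, ← Real.exp_add, ← Real.exp_add, hmark, signKL,
    Real.log_div h1t.ne' h1s.ne', Real.log_div h1t'.ne' h1s'.ne']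
  ring_nf

end Tilt

section Numerics

theorem entropy_series_le {t : ℝ} (h0 : 0 ≤ t) (h1 : t < 1) (n : ℕ) :
    ∑ k ∈ Finset.range n, t ^ (2 * k + 2) / ((2 * k + 1) * (k + 1)) ≤
      (1 + t) * Real.log (1 + t) + (1 - t) * Real.log (1 - t) := by
  have hsum := ((Real.hasSum_log_sub_log_of_abs_lt_one (abs_lt.2 ⟨by linarith, h1⟩)).mul_left t).sub
    (Real.hasSum_pow_div_log_of_abs_lt_one (x := t ^ 2) (abs_lt.2 ⟨by nlinarith, by nlinarith⟩))
  have hterm (k : ℕ) : t * (2 * (1 / (2 * (k : ℝ) + 1)) * t ^ (2 * k + 1)) -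
      (t ^ 2) ^ (k + 1) / ((k : ℝ) + 1) = t ^ (2 * k + 2) / ((2 * k + 1) * (k + 1)) := by
    rw [← pow_mul]
    field_simp
    ring
  have hval : t * (Real.log (1 + t) - Real.log (1 - t)) - -Real.log (1 - t ^ 2) =
      (1 + t) * Real.log (1 + t) + (1 - t) * Real.log (1 - t) := by
    rw [show 1 - t ^ 2 = (1 + t) * (1 - t) by ring, Real.log_mul (by linarith) (by linarith)]
    ring
  simp only [hterm, hval] at hsum
  exact sum_le_hasSum _ (fun k _ => by positivity) hsum

theorem log_one_add_sub_log_one_sub_le {s : ℝ} (h0 : 0 ≤ s) (h1 : s < 1) :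
    Real.log (1 + s) - Real.log (1 - s) ≤ 2 * s / (1 - s ^ 2) := by
  have hs : 0 < 1 - s := by linarith
  have hs' : 0 < 1 + s := by linarith
  have hsinh := Real.self_le_sinh_iff.2
    (sub_nonneg.2 (Real.log_le_log hs (show 1 - s ≤ 1 + s by linarith)))
  refine hsinh.trans_eq ?_
  rw [Real.sinh_eq, neg_sub, Real.exp_sub, Real.exp_sub, Real.exp_log hs, Real.exp_log hs',
    show 1 - s ^ 2 = (1 - s) * (1 + s) by ring]
  field_simp
  ring

theorem two_mul_signKL {t s : ℝ} (ht : t ∈ Set.Ioo (-1) 1) (hs : s ∈ Set.Ioo (-1) 1) :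
    2 * signKL t s = ((1 + t) * Real.log (1 + t) + (1 - t) * Real.log (1 - t)) -
      Real.log (1 - s ^ 2) - t * (Real.log (1 + s) - Real.log (1 - s)) := by
  have h1s : 1 + s ≠ 0 := by linarith [hs.1]
  have h1s' : 1 - s ≠ 0 := by linarith [hs.2]
  rw [signKL, Real.log_div (by linarith [ht.1]) h1s, Real.log_div (by linarith [ht.2]) h1s',
    show 1 - s ^ 2 = (1 + s) * (1 - s) by ring, Real.log_mul h1s h1s']
  ring

theorem quartic_le_two_mul_signKL {t : ℝ} (h0 : 0 < t) (h1 : t < 1) :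
    t ^ 2 * (31 + 13 * t ^ 2) / 40 ≤ 2 * signKL t (t / 12) := by
  have hentropy := entropy_series_le h0.le h1 5
  have hsq : Real.log (1 - (t / 12) ^ 2) ≤ -(t / 12) ^ 2 := by
    linarith [Real.log_le_sub_one_of_pos (show 0 < 1 - (t / 12) ^ 2 by nlinarith)]
  have hlog : Real.log (1 + t / 12) - Real.log (1 - t / 12) ≤ t * (24 / 143) := by
    refine (log_one_add_sub_log_one_sub_le (by positivity) (by linarith)).trans ?_
    rw [div_le_iff₀ (by nlinarith)]
    nlinarith [mul_nonneg h0.le (show 0 ≤ 1 - t ^ 2 by nlinarith)]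
  have hpoly : 0 ≤ t ^ 2 * (641 / 10000 - 19 / 120 * t ^ 2 + (t ^ 2) ^ 2 / 15 + (t ^ 2) ^ 3 / 28 +
      (t ^ 2) ^ 4 / 45) := by
    refine mul_nonneg (sq_nonneg t) ?_
    generalize hv : t ^ 2 = v
    have hv0 : 0 ≤ v := hv ▸ sq_nonneg t
    nlinarith [sq_nonneg (v - 13 / 20), mul_nonneg hv0 (sq_nonneg (v - 13 / 20)),
      sq_nonneg (v ^ 2 - 169 / 400)]
  rw [two_mul_signKL ⟨by linarith, h1⟩ ⟨by linarith, by linarith⟩]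
  simp only [Finset.sum_range_succ, Finset.sum_range_zero] at hentropy
  norm_num at hentropy
  nlinarith [mul_le_mul_of_nonneg_left hlog h0.le, sq_nonneg t]

theorem exp_eight_fifths_lt : Real.exp (8 / 5) < 4.993 := by
  refine lt_of_pow_lt_pow_left₀ 5 (by norm_num) ?_
  rw [← Real.exp_nat_mul, show ((5 : ℕ) : ℝ) * (8 / 5) = ((8 : ℕ) : ℝ) * 1 by norm_num,
    Real.exp_nat_mul]
  calc Real.exp 1 ^ 8 < 2.7182818286 ^ 8 := by gcongr; exact Real.exp_one_lt_d9
    _ < 4.993 ^ 5 := by norm_num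

theorem thirteen_fifths_le {x : ℝ} (hx : 1 ≤ x) (h : 2 * x ≤ Real.exp (x - 1)) : 13 / 5 ≤ x := by
  by_contra! hlt
  -- On `[1, 13 / 5]`, `exp (x - 1)` lies below its chord, which is less than `2 * x`.
  have hchord := convexOn_exp.2 (Set.mem_univ 0) (Set.mem_univ (8 / 5))
    (show 0 ≤ 1 - 5 / 8 * (x - 1) by linarith) (show 0 ≤ 5 / 8 * (x - 1) by linarith) (by ring)
  simp only [smul_eq_mul, mul_zero, zero_add, Real.exp_zero, mul_one] at hchord
  rw [show 5 / 8 * (x - 1) * (8 / 5) = x - 1 by ring] at hchord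
  nlinarith [exp_eight_fifths_lt]

theorem monotoneOn_two_mul_log_sub :
    MonotoneOn (fun x : ℝ => 2 * Real.log x - Real.log (29 / 5 - x) - x)
      (Set.Ico (13 / 5) (29 / 5)) := by
  have hderiv (x : ℝ) (h0 : 13 / 5 ≤ x) (h1 : x < 29 / 5) :
      HasDerivAt (fun x : ℝ => 2 * Real.log x - Real.log (29 / 5 - x) - x)
        (2 * x⁻¹ - -1 / (29 / 5 - x) - 1) x :=
    (((Real.hasDerivAt_log (by linarith)).const_mul 2).sub
      (((hasDerivAt_id x).const_sub _).log (by simp only [id]; linarith))).sub (hasDerivAt_id x)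
  refine monotoneOn_of_deriv_nonneg (convex_Ico _ _)
    (fun x hx => (hderiv x hx.1 hx.2).continuousAt.continuousWithinAt)
    (fun x hx => ?_) fun x hx => ?_ <;> rw [interior_Ico] at hx
  · exact (hderiv x hx.1.le hx.2).differentiableAt.differentiableWithinAt
  · have hx0 : 0 < x := by linarith [hx.1]
    have hx1 : 0 < 29 / 5 - x := by linarith [hx.2]
    rw [(hderiv x hx.1.le hx.2).deriv]
    have : 2 * x⁻¹ - -1 / (29 / 5 - x) - 1 =
        ((x - 17 / 5) ^ 2 + 1 / 25) / (x * (29 / 5 - x)) := by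
      generalize hy : 29 / 5 - x = y at hx1 ⊢
      field_simp
      rw [← hy]
      ring
    rw [this]
    positivity

theorem log_twenty_four_le {x : ℝ} (hx : 13 / 5 ≤ x) :
    Real.log 24 ≤ 11 / 20 * x + 13 / 10 * x ^ 2 / Real.exp (x - 1) := by
  have hlog24 : Real.log 24 ≤ 319 / 100 := by
    rw [show (24 : ℝ) = 2 ^ 3 * 3 by norm_num, Real.log_mul (by norm_num) (by norm_num),
      Real.log_pow]
    push_cast
    linarith [Real.log_two_lt_d9, Real.log_three_lt_d9]
  refine hlog24.trans ?_
  -- `319 / 100 = 11 / 20 * (29 / 5)`, so only `x < 29 / 5` needs the second summand.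
  rcases lt_or_ge x (29 / 5) with hx1 | hx1
  · have hy : 0 < 29 / 5 - x := by linarith
    have hmono := monotoneOn_two_mul_log_sub ⟨le_rfl, by norm_num⟩ ⟨hx, hx1⟩ hx
    have hlog : x - 1 + Real.log (29 / 5 - x) ≤ 8 / 5 + Real.log (80 / 169 * x ^ 2) := by
      have hquot : Real.log (80 / 169 * x ^ 2) =
          Real.log (29 / 5 - 13 / 5) - 2 * Real.log (13 / 5) + 2 * Real.log x := by
        rw [Real.log_mul (by norm_num) (by positivity), Real.log_pow,
          show (80 / 169 : ℝ) = (29 / 5 - 13 / 5) / (13 / 5) ^ 2 by norm_num,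
          Real.log_div (by norm_num) (by norm_num), Real.log_pow]
        norm_num
      dsimp only at hmono
      linarith
    have hexp := Real.exp_le_exp.2 hlog
    rw [Real.exp_add, Real.exp_add, Real.exp_log hy, Real.exp_log (by positivity)] at hexp
    rw [← sub_le_iff_le_add', le_div_iff₀ (Real.exp_pos _)]
    nlinarith [mul_le_mul_of_nonneg_right exp_eight_fifths_lt.le (sq_nonneg x)]
  · have := div_nonneg (show 0 ≤ 13 / 10 * x ^ 2 by positivity) (Real.exp_pos (x - 1)).le
    linarith

theorem half_mul_sq_add_mul_log_le {m d t : ℝ} (hd : 0 ≤ d) (hdm : d ≤ m) (h0 : 0 < t) (h1 : t < 1)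
    (ht : d * Real.log (Real.exp 1 * m / d) ≤ m * t ^ 2 / 2) :
    m * t ^ 2 / 2 + d * Real.log 24 ≤ 2 * m * signKL t (t / 12) := by
  have hquartic := quartic_le_two_mul_signKL h0 h1
  rcases hd.eq_or_lt with rfl | hd0
  · nlinarith [mul_le_mul_of_nonneg_left hquartic hdm, mul_nonneg hdm (sq_nonneg t),
      mul_nonneg hdm (sq_nonneg (t ^ 2))]
  have hm0 : 0 < m := hd0.trans_le hdm
  set L := Real.log (Real.exp 1 * m / d) with hL
  have hL1 : 1 ≤ L := by
    rw [hL, Real.le_log_iff_exp_le (by positivity), le_div_iff₀ hd0]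
    gcongr
  have hexp : Real.exp (L - 1) = m / d := by
    rw [Real.exp_sub, hL, Real.exp_log (by positivity)]
    field_simp
  have hsq : 2 * L / (m / d) ≤ t ^ 2 := by
    rw [div_le_iff₀ (by positivity)]
    field_simp
    linarith
  have hL13 : 13 / 5 ≤ L := by
    refine thirteen_fifths_le hL1 ?_
    rw [hexp, ← div_le_one (by positivity)]
    nlinarith
  have hlog24 := log_twenty_four_le hL13
  rw [hexp] at hlog24
  calc m * t ^ 2 / 2 + d * Real.log 24
      ≤ m * t ^ 2 / 2 + d * L * (11 / 20 + 13 / 20 * (2 * L / (m / d))) := by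
        have := mul_le_mul_of_nonneg_left hlog24 hd0.le
        refine add_le_add_right (this.trans_eq ?_) _
        ring
    _ ≤ m * t ^ 2 / 2 + m * t ^ 2 / 2 * (11 / 20 + 13 / 20 * t ^ 2) := by gcongr
    _ = m * (t ^ 2 * (31 + 13 * t ^ 2) / 40) := by ring
    _ ≤ 2 * m * signKL t (t / 12) := by nlinarith

theorem two_mul_sum_choose_mul_exp_le {m d : ℕ} (hdm : d ≤ m) {t c : ℝ} (h0 : 0 < t) (h1 : t < 1)
    (hc : 0 ≤ c) (ht : m * t ^ 2 / 2 = c + d * Real.log (Real.exp 1 * m / d)) :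
    2 * ((∑ i ∈ Finset.Iic d, (2 * m * 12).choose i : ℕ) : ℝ) *
      Real.exp (-(2 * m * signKL t (t / 12))) ≤ 2 * Real.exp (-c) := by
  have hrate := half_mul_sq_add_mul_log_le (Nat.cast_nonneg d) (Nat.cast_le.2 hdm) h0 h1
    (show d * Real.log (Real.exp 1 * m / d) ≤ m * t ^ 2 / 2 by linarith)
  have hlog : d * Real.log (Real.exp 1 * (2 * m * 12 : ℕ) / d) =
      d * Real.log (Real.exp 1 * m / d) + d * Real.log 24 := by
    rcases Nat.eq_zero_or_pos d with rfl | hd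
    · simp
    have hm : (0 : ℝ) < m := mod_cast hd.trans_le hdm
    rw [← mul_add, ← Real.log_mul (by positivity) (by norm_num)]
    push_cast
    ring_nf
  rw [mul_assoc]
  gcongr
  calc _ ≤ Real.exp (d * Real.log (Real.exp 1 * (2 * m * 12 : ℕ) / d)) *
        Real.exp (-(2 * m * signKL t (t / 12))) := by
        gcongr
        exact sum_choose_le_exp (by omega)
    _ ≤ Real.exp (-c) := by
        rw [← Real.exp_add, hlog]
        exact Real.exp_le_exp.2 (by linarith)

theorem mul_log_exp_one_mul_div_nonneg {m d : ℕ} (hdm : d ≤ m) :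
    0 ≤ d * Real.log (Real.exp 1 * m / d) := by
  rcases d.eq_zero_or_pos with rfl | hd
  · simp
  have hd0 : (0 : ℝ) < d := mod_cast hd
  have hdm' : (d : ℝ) ≤ m := mod_cast hdm
  refine mul_nonneg hd0.le (Real.log_nonneg ((one_le_div hd0).2 (hdm'.trans ?_)))
  exact le_mul_of_one_le_left (Nat.cast_nonneg m) (Real.one_le_exp zero_le_one)

end Numerics

section LabelSum

variable {X J : Type*} [Fintype J]

/-- The weighted number of positive labels. -/
noncomputable def labelSum (w : J → ℝ) (p : J → Bool) : ℝ :=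
  ∑ j, w j * (if p j = true then 1 else 0)

/-- The supremum over the class of the absolute weighted number of positive labels. -/
noncomputable def labelSup (H : Set (X → Bool)) (w : J → ℝ) (z : J → X) : ℝ :=
  ⨆ h : H, |labelSum w fun j => (h : X → Bool) (z j)|

theorem abs_labelSum_le (w : J → ℝ) (p : J → Bool) : |labelSum w p| ≤ ∑ j, |w j| := by
  refine (Finset.abs_sum_le_sum_abs _ _).trans (Finset.sum_le_sum fun j _ => ?_)
  split_ifs <;> simp

theorem bddAbove_labelSum (H : Set (X → Bool)) (w : J → ℝ) (z : J → X) :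
    BddAbove (Set.range fun h : H => |labelSum w fun j => (h : X → Bool) (z j)|) :=
  ⟨∑ j, |w j|, by rintro _ ⟨h, rfl⟩; exact abs_labelSum_le _ _⟩

theorem abs_labelSum_le_labelSup {H : Set (X → Bool)} (w : J → ℝ) (z : J → X) {h : X → Bool}
    (hh : h ∈ H) : |labelSum w fun j => h (z j)| ≤ labelSup H w z :=
  le_ciSup (bddAbove_labelSum H w z) ⟨h, hh⟩

theorem exp_labelSup_le_sum {H : Set (X → Bool)} (hH : H.Nonempty) (w : J → ℝ) (z : J → X) :
    Real.exp (labelSup H w z) ≤ ∑ p ∈ labellings H z, Real.exp |labelSum w p| := by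
  have := hH.to_subtype
  have hle (h : H) : Real.exp |labelSum w fun j => (h : X → Bool) (z j)| ≤
      ∑ p ∈ labellings H z, Real.exp |labelSum w p| :=
    Finset.single_le_sum (f := fun p => Real.exp |labelSum w p|) (fun p _ => (Real.exp_pos _).le)
      (mem_labellings.2 ⟨h, h.2, rfl⟩)
  have hpos : 0 < ∑ p ∈ labellings H z, Real.exp |labelSum w p| :=
    (Real.exp_pos _).trans_le (hle (Classical.arbitrary H))
  rw [← Real.le_log_iff_exp_le hpos]
  exact ciSup_le fun h => (Real.le_log_iff_exp_le hpos).2 (hle h)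

end LabelSum

section Blocks

variable {ι κ : Type*} [Fintype ι] [Fintype κ]

/-- A label as a sign. -/
def labelSign (b : Bool) : ℝ := if b = true then 1 else -1

/-- The average sign of the labels in a block. -/
noncomputable def blockMean (q : κ → Bool) : ℝ := (∑ o, labelSign (q o)) / Fintype.card κ

theorem sum_exp_labelSign [Nonempty κ] (a : ℝ) {e : ℝ} (he : e = 1 ∨ e = -1) (q : κ → Bool) :
    ∑ o, Real.exp (e * (a * labelSign (q o))) =
      Fintype.card κ * (Real.cosh a + e * blockMean q * Real.sinh a) := by
  have hexp (b : Bool) : Real.exp (e * (a * labelSign b)) =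
      Real.cosh a + labelSign b * (e * Real.sinh a) := by
    rcases he with rfl | rfl <;> cases b <;>
      simp [labelSign, Real.cosh_add_sinh, ← sub_eq_add_neg, Real.cosh_sub_sinh]
  simp only [hexp, Finset.sum_add_distrib, ← Finset.sum_mul, blockMean, Finset.sum_const,
    Finset.card_univ, nsmul_eq_mul]
  field_simp

theorem sum_exp_block_le [Nonempty κ] {a g B e : ℝ}
    (hB : ∀ u, Real.cosh a + u * Real.sinh a ≤ B * Real.exp (g * u)) (he : e = 1 ∨ e = -1)
    (q : κ → Bool) :
    ∑ o, Real.exp (e * (a * labelSign (q o) - g * blockMean q)) ≤ Fintype.card κ * B := by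
  calc ∑ o, Real.exp (e * (a * labelSign (q o) - g * blockMean q))
      = (∑ o, Real.exp (e * (a * labelSign (q o)))) * Real.exp (-(g * (e * blockMean q))) := by
        rw [Finset.sum_mul]
        refine Finset.sum_congr rfl fun o _ => ?_
        rw [← Real.exp_add]
        ring_nf
    _ ≤ Fintype.card κ * (B * Real.exp (g * (e * blockMean q))) *
          Real.exp (-(g * (e * blockMean q))) := by
        rw [sum_exp_labelSign a he]
        gcongr
        exact hB _
    _ = Fintype.card κ * B := by
        rw [mul_assoc, mul_assoc, ← Real.exp_add, add_neg_cancel, Real.exp_zero, mul_one]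

variable [DecidableEq κ]

/-- The weights of the tilted exchange argument. The sample consists of blocks of points indexed
by `κ`, one block for each `i : ι`, and `σ i` is the position of the original point of block `i`,
the other points being ghosts. With `ε i` a sign, the original point is tilted by `2 * a` and the
average of its block by `-2 * g`. -/
noncomputable def ghostWeight (ε : ι → ℝ) (a g : ℝ) (σ : ι → κ) (j : ι × κ) : ℝ :=
  ε j.1 * ((if j.2 = σ j.1 then 2 * a else 0) - 2 * g / Fintype.card κ)

theorem labelSum_ghostWeight [Nonempty κ] {ε : ι → ℝ} (hε : ∑ i, ε i = 0) (a g : ℝ) (σ : ι → κ)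
    (p : ι × κ → Bool) :
    labelSum (ghostWeight ε a g σ) p =
      ∑ i, ε i * (a * labelSign (p (i, σ i)) - g * blockMean fun o => p (i, o)) := by
  have hind (b : Bool) : (if b = true then 1 else 0 : ℝ) = (labelSign b + 1) / 2 := by
    cases b <;> norm_num [labelSign]
  have hblock (i : ι) : ∑ o, ghostWeight ε a g σ (i, o) * (if p (i, o) = true then 1 else 0) =
      ε i * (a * labelSign (p (i, σ i)) - g * blockMean fun o => p (i, o)) + ε i * (a - g) := by
    simp only [hind, ghostWeight, blockMean, mul_assoc, ← Finset.mul_sum, sub_mul, ite_mul,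
      zero_mul, Finset.sum_sub_distrib, Finset.sum_ite_eq', Finset.mem_univ,
      if_true, ← Finset.sum_div, Finset.sum_add_distrib, Finset.sum_const, Finset.card_univ,
      nsmul_eq_mul]
    field_simp
    ring
  rw [labelSum, Fintype.sum_prod_type, Finset.sum_congr rfl fun i _ => hblock i,
    Finset.sum_add_distrib, ← Finset.sum_mul, hε, zero_mul, add_zero]

theorem sum_exp_labelSum_ghostWeight_le [DecidableEq ι] [Nonempty κ] {a g B : ℝ} {ε : ι → ℝ}
    (hB : ∀ u, Real.cosh a + u * Real.sinh a ≤ B * Real.exp (g * u))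
    (hε : ∀ i, ε i = 1 ∨ ε i = -1) (hsum : ∑ i, ε i = 0) (p : ι × κ → Bool) :
    ∑ σ : ι → κ, Real.exp (labelSum (ghostWeight ε a g σ) p) ≤
      (Fintype.card κ * B) ^ Fintype.card ι := by
  calc ∑ σ : ι → κ, Real.exp (labelSum (ghostWeight ε a g σ) p)
      = ∏ i, ∑ o, Real.exp
          (ε i * (a * labelSign (p (i, o)) - g * blockMean fun o => p (i, o))) := by
        simp only [Fintype.prod_sum, labelSum_ghostWeight hsum, Real.exp_sum]
    _ ≤ ∏ _i : ι, (Fintype.card κ * B) :=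
        Finset.prod_le_prod (fun i _ => Finset.sum_nonneg fun o _ => (Real.exp_pos _).le)
          fun i _ => sum_exp_block_le hB (hε i) _
    _ = (Fintype.card κ * B) ^ Fintype.card ι := by simp

theorem sum_exp_abs_labelSum_ghostWeight_le [DecidableEq ι] [Nonempty κ] {a g B : ℝ} {ε : ι → ℝ}
    (hB : ∀ u, Real.cosh a + u * Real.sinh a ≤ B * Real.exp (g * u))
    (hε : ∀ i, ε i = 1 ∨ ε i = -1) (hsum : ∑ i, ε i = 0) (p : ι × κ → Bool) :
    ∑ σ : ι → κ, Real.exp |labelSum (ghostWeight ε a g σ) p| ≤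
      2 * (Fintype.card κ * B) ^ Fintype.card ι := by
  have hneg (σ : ι → κ) : -labelSum (ghostWeight ε a g σ) p =
      labelSum (ghostWeight (-ε) a g σ) p := by
    simp only [labelSum, ghostWeight, Pi.neg_apply, neg_mul, Finset.sum_neg_distrib]
  calc ∑ σ : ι → κ, Real.exp |labelSum (ghostWeight ε a g σ) p|
      ≤ ∑ σ : ι → κ, (Real.exp (labelSum (ghostWeight ε a g σ) p) +
          Real.exp (labelSum (ghostWeight (-ε) a g σ) p)) :=
        Finset.sum_le_sum fun σ _ => hneg σ ▸ Real.exp_abs_le _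
    _ ≤ (Fintype.card κ * B) ^ Fintype.card ι + (Fintype.card κ * B) ^ Fintype.card ι := by
        rw [Finset.sum_add_distrib]
        refine add_le_add (sum_exp_labelSum_ghostWeight_le hB hε hsum p)
          (sum_exp_labelSum_ghostWeight_le hB (fun i => ?_) (by simp [hsum]) p)
        simpa [neg_eq_iff_eq_neg, or_comm] using hε i
    _ = 2 * (Fintype.card κ * B) ^ Fintype.card ι := (two_mul _).symm

theorem sum_exp_labelSup_ghostWeight_le [DecidableEq ι] [Nonempty κ] {X : Type*}
    {H : Set (X → Bool)} (hH : H.Nonempty) {a g B : ℝ} {ε : ι → ℝ}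
    (hB : ∀ u, Real.cosh a + u * Real.sinh a ≤ B * Real.exp (g * u))
    (hε : ∀ i, ε i = 1 ∨ ε i = -1) (hsum : ∑ i, ε i = 0) (z : ι × κ → X) :
    ∑ σ : ι → κ, Real.exp (labelSup H (ghostWeight ε a g σ) z) ≤
      (labellings H z).card * (2 * (Fintype.card κ * B) ^ Fintype.card ι) := by
  calc ∑ σ : ι → κ, Real.exp (labelSup H (ghostWeight ε a g σ) z)
      ≤ ∑ σ : ι → κ, ∑ p ∈ labellings H z, Real.exp |labelSum (ghostWeight ε a g σ) p| :=
        Finset.sum_le_sum fun σ _ => exp_labelSup_le_sum hH _ z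
    _ = ∑ p ∈ labellings H z, ∑ σ : ι → κ, Real.exp |labelSum (ghostWeight ε a g σ) p| :=
        Finset.sum_comm
    _ ≤ ∑ _p ∈ labellings H z, 2 * (Fintype.card κ * B) ^ Fintype.card ι :=
        Finset.sum_le_sum fun p _ => sum_exp_abs_labelSum_ghostWeight_le hB hε hsum p
    _ = (labellings H z).card * (2 * (Fintype.card κ * B) ^ Fintype.card ι) := by simp

end Blocks

section Exchange

variable {X J J' : Type*} [Fintype J] [Fintype J']

theorem labelSum_comp_equiv (w : J' → ℝ) (p : J' → Bool) (e : J ≃ J') :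
    labelSum (w ∘ e) (p ∘ e) = labelSum w p :=
  Equiv.sum_comp e fun j => w j * (if p j = true then 1 else 0)

theorem labelSup_comp_equiv (H : Set (X → Bool)) (w : J' → ℝ) (z : J' → X) (e : J ≃ J') :
    labelSup H (w ∘ e) (z ∘ e) = labelSup H w z :=
  iSup_congr fun h => congrArg abs (labelSum_comp_equiv w (fun j => (h : X → Bool) (z j)) e)

variable [MeasurableSpace X]

theorem measurePreserving_comp_equiv (P : J' → Measure X) [∀ j, SigmaFinite (P j)] (e : J ≃ J') :
    MeasurePreserving (fun z : J' → X => z ∘ e) (Measure.pi P) (Measure.pi fun j => P (e j)) :=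
  (measurePreserving_piCongrLeft P e).symm

theorem IsMeasurableClass.aemeasurable_labelSup {H : Set (X → Bool)} {D : Set (Measure X)}
    (hreg : IsMeasurableClass H D) (P : J → Measure X) [∀ j, SigmaFinite (P j)]
    (hP : ∀ j, P j ∈ D) (w : J → ℝ) : AEMeasurable (labelSup H w) (Measure.pi P) := by
  let e := (Fintype.equivFin J).symm
  have hfin : AEMeasurable (labelSup H (w ∘ e)) (Measure.pi fun j => P (e j)) :=
    hreg _ _ (fun j => hP _) _
  simpa only [Function.comp_def (labelSup H (w ∘ e)), labelSup_comp_equiv] using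
    hfin.comp_quasiMeasurePreserving (measurePreserving_comp_equiv P e).quasiMeasurePreserving

theorem lintegral_exp_labelSup_comp_equiv (H : Set (X → Bool)) (w : J' → ℝ) (P : J' → Measure X)
    [∀ j, SigmaFinite (P j)] (e : J ≃ J') :
    ∫⁻ z, ENNReal.ofReal (Real.exp (labelSup H (w ∘ e) z)) ∂Measure.pi (fun j => P (e j)) =
      ∫⁻ z, ENNReal.ofReal (Real.exp (labelSup H w z)) ∂Measure.pi P := by
  have hmap := (measurePreserving_piCongrLeft P e).symm.lintegral_map_equiv
    fun z => ENNReal.ofReal (Real.exp (labelSup H (w ∘ e) z))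
  exact hmap.trans
    (lintegral_congr fun z => congrArg (ENNReal.ofReal ∘ Real.exp) (labelSup_comp_equiv H w z e))

variable {ι κ : Type*} [Fintype ι] [Fintype κ] [DecidableEq κ]

theorem lintegral_exp_labelSup_ghostWeight_eq (H : Set (X → Bool)) (ε : ι → ℝ) (a g : ℝ)
    (Q : ι → Measure X) [∀ i, SigmaFinite (Q i)] (σ τ : ι → κ) :
    ∫⁻ z, ENNReal.ofReal (Real.exp (labelSup H (ghostWeight ε a g σ) z))
        ∂Measure.pi (fun j : ι × κ => Q j.1) =
      ∫⁻ z, ENNReal.ofReal (Real.exp (labelSup H (ghostWeight ε a g τ) z))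
        ∂Measure.pi (fun j : ι × κ => Q j.1) := by
  let e : ι × κ ≃ ι × κ := Equiv.prodShear (Equiv.refl ι) fun i => Equiv.swap (σ i) (τ i)
  have hweight : ghostWeight ε a g τ ∘ e = ghostWeight ε a g σ := by
    funext j
    simp [e, ghostWeight, Equiv.swap_apply_eq_iff]
  rw [← hweight]
  exact lintegral_exp_labelSup_comp_equiv H _ (fun j : ι × κ => Q j.1) e

-- The integral does not depend on `σ`, so it equals its average over all `σ`, which can be bounded
-- pointwise.
theorem lintegral_exp_labelSup_ghostWeight_le [Nonempty κ] {H : Set (X → Bool)}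
    {d : ℕ} (hVC : HasVCDim H d) {D : Set (Measure X)} (hreg : IsMeasurableClass H D) {a g B : ℝ}
    {ε : ι → ℝ} (hB : ∀ u, Real.cosh a + u * Real.sinh a ≤ B * Real.exp (g * u))
    (hε : ∀ i, ε i = 1 ∨ ε i = -1) (hsum : ∑ i, ε i = 0) (Q : ι → Measure X)
    [∀ i, IsProbabilityMeasure (Q i)] (hQ : ∀ i, Q i ∈ D) (σ : ι → κ) :
    ∫⁻ z, ENNReal.ofReal (Real.exp (labelSup H (ghostWeight ε a g σ) z))
        ∂Measure.pi (fun j : ι × κ => Q j.1) ≤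
      ENNReal.ofReal (2 * (∑ i ∈ Finset.Iic d, (Fintype.card ι * Fintype.card κ).choose i : ℕ) *
        B ^ Fintype.card ι) := by
  classical
  set N : ℕ := ∑ i ∈ Finset.Iic d, (Fintype.card ι * Fintype.card κ).choose i
  set ν := Measure.pi fun j : ι × κ => Q j.1
  set F : (ι → κ) → (ι × κ → X) → ℝ≥0∞ := fun τ z =>
    ENNReal.ofReal (Real.exp (labelSup H (ghostWeight ε a g τ) z))
  have hB0 : 0 ≤ B := by simpa using (Real.cosh_pos a).le.trans (by simpa using hB 0)
  have hF (τ : ι → κ) : AEMeasurable (F τ) ν :=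
    (hreg.aemeasurable_labelSup (fun j : ι × κ => Q j.1) (fun j => hQ j.1) _).exp.ennreal_ofReal
  have hpoint (z : ι × κ → X) : ∑ τ, F τ z ≤
      Fintype.card (ι → κ) * ENNReal.ofReal (2 * N * B ^ Fintype.card ι) := by
    have hcard : (labellings H z).card ≤ N := by
      simpa only [Fintype.card_prod] using hVC.card_labellings_le z
    rw [← ENNReal.ofReal_sum_of_nonneg fun τ _ => (Real.exp_pos _).le,
      ← ENNReal.ofReal_natCast, ← ENNReal.ofReal_mul (Nat.cast_nonneg _)]
    refine ENNReal.ofReal_le_ofReal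
      ((sum_exp_labelSup_ghostWeight_le hVC.nonempty hB hε hsum z).trans ?_)
    calc ((labellings H z).card : ℝ) * (2 * (Fintype.card κ * B) ^ Fintype.card ι)
        ≤ N * (2 * (Fintype.card κ * B) ^ Fintype.card ι) := by gcongr
      _ = Fintype.card (ι → κ) * (2 * N * B ^ Fintype.card ι) := by
          rw [Fintype.card_fun]
          push_cast
          ring
  refine (ENNReal.mul_le_mul_iff_right (Nat.cast_ne_zero.2 (Fintype.card_ne_zero (α := ι → κ)))
    (ENNReal.natCast_ne_top _)).1 ?_
  calc Fintype.card (ι → κ) * ∫⁻ z, F σ z ∂ν = ∑ τ, ∫⁻ z, F τ z ∂ν := by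
        simp [F, ν, lintegral_exp_labelSup_ghostWeight_eq H ε a g Q _ σ]
    _ = ∫⁻ z, ∑ τ, F τ z ∂ν := (lintegral_finsetSum' _ fun τ _ => hF τ).symm
    _ ≤ ∫⁻ _z, Fintype.card (ι → κ) * ENNReal.ofReal (2 * N * B ^ Fintype.card ι) ∂ν :=
        lintegral_mono hpoint
    _ = Fintype.card (ι → κ) * ENNReal.ofReal (2 * N * B ^ Fintype.card ι) := by simp [ν]

end Exchange

section Means

variable {X J : Type*} [MeasurableSpace X] [Fintype J]

/-- The expectation of the weighted number of positive labels of random points with laws `P j`. -/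
noncomputable def meanSum (w : J → ℝ) (P : J → Measure X) (h : X → Bool) : ℝ :=
  ∑ j, w j * (P j).real (h ⁻¹' {true})

/-- The supremum over the class of the absolute expected weighted number of positive labels. -/
noncomputable def meanSup (H : Set (X → Bool)) (w : J → ℝ) (P : J → Measure X) : ℝ :=
  ⨆ h : H, |meanSum w P h|

theorem abs_meanSum_le_meanSup {H : Set (X → Bool)} (w : J → ℝ) (P : J → Measure X)
    [∀ j, IsProbabilityMeasure (P j)] {h : X → Bool} (hh : h ∈ H) :
    |meanSum w P h| ≤ meanSup H w P := by
  refine le_ciSup (f := fun h : H => |meanSum w P h|) ⟨∑ j, |w j|, ?_⟩ ⟨h, hh⟩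
  rintro _ ⟨h, rfl⟩
  refine (Finset.abs_sum_le_sum_abs _ _).trans (Finset.sum_le_sum fun j _ => ?_)
  rw [abs_mul, abs_of_nonneg measureReal_nonneg]
  exact mul_le_of_le_one_right (abs_nonneg _) measureReal_le_one

theorem measurable_label {h : X → Bool} (hh : Measurable h) :
    Measurable fun x => if h x = true then (1 : ℝ) else 0 :=
  (measurable_of_finite fun b : Bool => if b = true then (1 : ℝ) else 0).comp hh

theorem integral_label {h : X → Bool} (hh : Measurable h) (P : Measure X) :
    ∫ x, (if h x = true then (1 : ℝ) else 0) ∂P = P.real (h ⁻¹' {true}) := by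
  rw [← integral_indicator_one (hh (measurableSet_singleton true))]
  exact integral_congr_ae (.of_forall fun x => by simp [Set.indicator])

theorem measurable_labelSum (w : J → ℝ) {h : X → Bool} (hh : Measurable h) :
    Measurable fun z : J → X => labelSum w fun j => h (z j) :=
  Finset.measurable_sum _ fun j _ =>
    ((measurable_label hh).comp (measurable_pi_apply j)).const_mul (w j)

theorem integral_labelSum (w : J → ℝ) (P : J → Measure X) [∀ j, IsProbabilityMeasure (P j)]
    {h : X → Bool} (hh : Measurable h) :
    ∫ z, labelSum w (fun j => h (z j)) ∂Measure.pi P = meanSum w P h := by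
  have hint (j : J) : Integrable (fun z : J → X => if h (z j) = true then (1 : ℝ) else 0)
      (Measure.pi P) :=
    .of_bound ((measurable_label hh).comp (measurable_pi_apply j)).aestronglyMeasurable 1
      (.of_forall fun z => by split_ifs <;> simp)
  simp only [labelSum, meanSum]
  rw [integral_finsetSum _ fun j _ => (hint j).const_mul (w j)]
  refine Finset.sum_congr rfl fun j _ => ?_
  rw [integral_const_mul, ← integral_label hh]
  exact congrArg _ (integral_comp_eval (μ := P) (i := j) (measurable_label hh).aestronglyMeasurable)

end Means

theorem exp_abs_integral_le_lintegral {Ω : Type*} [MeasurableSpace Ω] {μ : Measure Ω}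
    [IsProbabilityMeasure μ] {f : Ω → ℝ} (hf : AEStronglyMeasurable f μ) {C : ℝ}
    (hC : ∀ᵐ x ∂μ, |f x| ≤ C) :
    ENNReal.ofReal (Real.exp |∫ x, f x ∂μ|) ≤ ∫⁻ x, ENNReal.ofReal (Real.exp |f x|) ∂μ := by
  have hint : Integrable (fun x => |f x|) μ := (Integrable.of_bound hf C hC).abs
  have hexp : Integrable (fun x => Real.exp |f x|) μ := by
    refine .of_bound (Real.continuous_exp.comp_aestronglyMeasurable hint.aestronglyMeasurable)
      (Real.exp C) ?_
    filter_upwards [hC] with x hx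
    simpa using hx
  rw [← ofReal_integral_eq_lintegral_ofReal hexp (.of_forall fun x => (Real.exp_pos _).le)]
  refine ENNReal.ofReal_le_ofReal ?_
  calc Real.exp |∫ x, f x ∂μ| ≤ Real.exp (∫ x, |f x| ∂μ) :=
        Real.exp_le_exp.2 abs_integral_le_integral_abs
    _ ≤ ∫ x, Real.exp |f x| ∂μ :=
        convexOn_exp.map_integral_le Real.continuous_exp.continuousOn isClosed_univ
          (.of_forall fun _ => Set.mem_univ _) hint hexp

section Ghosts

variable {X : Type*} [MeasurableSpace X]

-- Jensen's inequality undoes the passage from the mean of the points `y` to a ghost sample.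
theorem exp_abs_labelSum_add_meanSum_le {J J' : Type*} [Fintype J] [Fintype J']
    {H : Set (X → Bool)} {h : X → Bool} (hh : h ∈ H) (hhm : Measurable h) (w : J ⊕ J' → ℝ)
    (P : J' → Measure X) [∀ j, IsProbabilityMeasure (P j)] (x : J → X) :
    ENNReal.ofReal (Real.exp |labelSum (w ∘ .inl) (fun j => h (x j)) + meanSum (w ∘ .inr) P h|) ≤
      ∫⁻ y, ENNReal.ofReal (Real.exp (labelSup H w (Sum.elim x y))) ∂Measure.pi P := by
  have hsum (y : J' → X) : labelSum (w ∘ .inl) (fun j => h (x j)) +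
      labelSum (w ∘ .inr) (fun j => h (y j)) = labelSum w fun j => h (Sum.elim x y j) :=
    (Fintype.sum_sum_type fun j => w j * (if h (Sum.elim x y j) = true then 1 else 0)).symm
  have hmeas : Measurable fun y : J' → X => labelSum w fun j => h (Sum.elim x y j) := by
    simp only [← hsum]
    exact (measurable_labelSum _ hhm).const_add _
  have hmean : ∫ y, labelSum w (fun j => h (Sum.elim x y j)) ∂Measure.pi P =
      labelSum (w ∘ .inl) (fun j => h (x j)) + meanSum (w ∘ .inr) P h := by
    simp only [← hsum]
    rw [integral_add (integrable_const _) (.of_bound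
      (measurable_labelSum _ hhm).aestronglyMeasurable _ (.of_forall fun y => abs_labelSum_le _ _)),
      integral_const, probReal_univ, one_smul, integral_labelSum _ _ hhm]
  rw [← hmean]
  refine (exp_abs_integral_le_lintegral hmeas.aestronglyMeasurable
    (.of_forall fun y => abs_labelSum_le _ _)).trans (lintegral_mono fun y => ?_)
  exact ENNReal.ofReal_le_ofReal (Real.exp_le_exp.2 (abs_labelSum_le_labelSup _ _ hh))

theorem measure_exists_le_abs_labelSum_add_meanSum_le {J J' : Type*} [Fintype J] [Fintype J']
    {H : Set (X → Bool)} (hH : ∀ h ∈ H, Measurable h) (w : J ⊕ J' → ℝ) (P : J ⊕ J' → Measure X)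
    [∀ j, IsProbabilityMeasure (P j)] (hsup : AEMeasurable (labelSup H w) (Measure.pi P)) (c : ℝ) :
    Measure.pi (fun j => P (.inl j)) {x | ∃ h ∈ H, c ≤
        |labelSum (w ∘ .inl) (fun j => h (x j)) + meanSum (w ∘ .inr) (fun j => P (.inr j)) h|} ≤
      (∫⁻ z, ENNReal.ofReal (Real.exp (labelSup H w z)) ∂Measure.pi P) /
        ENNReal.ofReal (Real.exp c) := by
  set F : (J ⊕ J' → X) → ℝ≥0∞ := fun z => ENNReal.ofReal (Real.exp (labelSup H w z))
  set R : (J → X) → ℝ≥0∞ := fun x =>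
    ∫⁻ y, F (Sum.elim x y) ∂Measure.pi fun j => P (.inr j)
  have hsplit := measurePreserving_sumPiEquivProdPi_symm P
  have hF : AEMeasurable (fun p : (J → X) × (J' → X) => F (Sum.elim p.1 p.2))
      ((Measure.pi fun j => P (.inl j)).prod (Measure.pi fun j => P (.inr j))) :=
    hsup.exp.ennreal_ofReal.comp_quasiMeasurePreserving hsplit.quasiMeasurePreserving
  calc Measure.pi (fun j => P (.inl j)) {x | ∃ h ∈ H, c ≤
        |labelSum (w ∘ .inl) (fun j => h (x j)) + meanSum (w ∘ .inr) (fun j => P (.inr j)) h|}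
      ≤ Measure.pi (fun j => P (.inl j)) {x | ENNReal.ofReal (Real.exp c) ≤ R x} := by
        refine measure_mono fun x ⟨h, hh, hc⟩ => ?_
        exact (ENNReal.ofReal_le_ofReal (Real.exp_le_exp.2 hc)).trans
          (exp_abs_labelSum_add_meanSum_le hh (hH h hh) w _ x)
    _ ≤ (∫⁻ x, R x ∂Measure.pi fun j => P (.inl j)) / ENNReal.ofReal (Real.exp c) :=
        meas_ge_le_lintegral_div hF.lintegral_prod_right' (by simpa using Real.exp_pos c)
          ENNReal.ofReal_ne_top
    _ = (∫⁻ z, F z ∂Measure.pi P) / ENNReal.ofReal (Real.exp c) := by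
        rw [← lintegral_prod _ hF]
        exact congrArg (· / _) (hsplit.lintegral_map_equiv F).symm

variable {ι κ : Type*}

/-- The points `ι × Option κ` of the blocks split into the observed points, in position `none`,
and the ghosts. -/
def ghostEquiv (ι κ : Type*) : ι ⊕ ι × κ ≃ ι × Option κ where
  toFun := Sum.elim (fun i => (i, none)) fun j => (j.1, some j.2)
  invFun j := j.2.elim (.inl j.1) fun o => .inr (j.1, o)
  left_inv := by rintro (i | j) <;> rfl
  right_inv := by rintro ⟨i, _ | o⟩ <;> rfl

variable [Fintype ι] [Fintype κ]

theorem labelSum_ghostWeight_inl [DecidableEq κ] (ε : ι → ℝ) (a g : ℝ) (p : ι → Bool) :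
    labelSum ((ghostWeight ε a g fun _ => none) ∘ ghostEquiv ι κ ∘ .inl) p =
      (2 * a - 2 * g / (Fintype.card κ + 1)) * labelSum ε p := by
  rw [labelSum, labelSum, Finset.mul_sum]
  refine Finset.sum_congr rfl fun i _ => ?_
  simp only [Function.comp_apply, ghostEquiv, Equiv.coe_fn_mk, Sum.elim_inl, ghostWeight, if_true,
    Fintype.card_option, Nat.cast_add, Nat.cast_one]
  ring

theorem meanSum_ghostWeight_inr [DecidableEq κ] (ε : ι → ℝ) (a g : ℝ) (Q : ι → Measure X)
    (h : X → Bool) :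
    meanSum ((ghostWeight ε a g fun _ => none) ∘ ghostEquiv ι κ ∘ .inr) (fun j => Q j.1) h =
      -(2 * g * Fintype.card κ / (Fintype.card κ + 1)) * meanSum ε Q h := by
  rw [meanSum, meanSum, Fintype.sum_prod_type, Finset.mul_sum]
  refine Finset.sum_congr rfl fun i _ => ?_
  simp only [Function.comp_apply, ghostEquiv, Equiv.coe_fn_mk, Sum.elim_inr, ghostWeight,
    reduceCtorEq, if_false, Fintype.card_option, Nat.cast_add, Nat.cast_one, Finset.sum_const,
    Finset.card_univ, nsmul_eq_mul]
  ring

-- `S` is the signed sum over the observed points, `E` its mean, and the two coefficients are the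
-- total weights of the observed point and of the ghosts of a block.
theorem mul_sub_le_abs_ghost_sum {a g c n t S E M N : ℝ} (hg : 0 ≤ g) (hga : g ≤ a) (hc : 0 ≤ c)
    (hn : n = c + 1) (hE : |E| ≤ M) (hS : M + N / 2 * t ≤ |S|) :
    N * (a * t - g * (t / n)) ≤ |(2 * a - 2 * g / n) * S + -(2 * g * c / n) * E| := by
  have hn0 : 0 < n := by linarith
  have hgn : g / n ≤ g := div_le_self hg (by linarith)
  have hM : 0 ≤ M := (abs_nonneg E).trans hE
  have hcoef : 0 ≤ 2 * a - 2 * g / n := by rw [mul_div_assoc]; linarith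
  have hcoef' : 0 ≤ 2 * g * c / n := by positivity
  calc N * (a * t - g * (t / n)) ≤ N * (a * t - g * (t / n)) + 2 * (a - g) * M :=
        le_add_of_nonneg_right (mul_nonneg (by linarith) hM)
    _ = (2 * a - 2 * g / n) * (M + N / 2 * t) - 2 * g * c / n * M := by
        field_simp
        rw [hn]
        ring
    _ ≤ (2 * a - 2 * g / n) * |S| - 2 * g * c / n * |E| := by gcongr
    _ = |(2 * a - 2 * g / n) * S| - |2 * g * c / n * E| := by
        rw [abs_mul, abs_mul, abs_of_nonneg hcoef, abs_of_nonneg hcoef']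
    _ ≤ |(2 * a - 2 * g / n) * S + -(2 * g * c / n) * E| := by
        rw [neg_mul, ← sub_eq_add_neg]
        exact abs_sub_abs_le_abs_sub _ _

theorem measure_meanSup_add_lt_labelSup_le (κ : Type*) [Fintype κ] {H : Set (X → Bool)}
    (hH : ∀ h ∈ H, Measurable h) {d : ℕ} (hVC : HasVCDim H d) {D : Set (Measure X)}
    (hreg : IsMeasurableClass H D) {ε : ι → ℝ} (hε : ∀ i, ε i = 1 ∨ ε i = -1) (hsum : ∑ i, ε i = 0)
    (Q : ι → Measure X) [∀ i, IsProbabilityMeasure (Q i)] (hQ : ∀ i, Q i ∈ D) {t : ℝ}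
    (h0 : 0 ≤ t) (h1 : t < 1) :
    Measure.pi Q {x | meanSup H ε Q + Fintype.card ι / 2 * t < labelSup H ε x} ≤
      ENNReal.ofReal (2 *
        (∑ i ∈ Finset.Iic d, (Fintype.card ι * (Fintype.card κ + 1)).choose i : ℕ) *
          Real.exp (-(Fintype.card ι * signKL t (t / (Fintype.card κ + 1))))) := by
  classical
  have := hVC.nonempty.to_subtype
  set n : ℝ := Fintype.card κ + 1 with hn
  set s := t / n
  have hs0 : 0 ≤ s := by positivity
  have hst : s ≤ t := div_le_self h0 (by simp [hn])
  have hsI : s ∈ Set.Ioo (-1) 1 := ⟨by linarith, by linarith⟩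
  have htI : t ∈ Set.Ioo (-1) 1 := ⟨by linarith, h1⟩
  set a := markTilt t s
  set g := blockTilt t s
  set w := (ghostWeight ε a g fun _ => none) ∘ ghostEquiv ι κ
  let P : ι × Option κ → Measure X := fun j => Q j.1
  set c := Fintype.card ι * (a * t - g * s) with hc
  have hghost : {x | meanSup H ε Q + Fintype.card ι / 2 * t < labelSup H ε x} ⊆
      {x | ∃ h ∈ H, c ≤ |labelSum (w ∘ .inl) (fun i => h (x i)) +
        meanSum (w ∘ .inr) (fun j : ι × κ => Q j.1) h|} := by
    intro x hx
    obtain ⟨⟨h, hh⟩, hS⟩ := exists_lt_of_lt_ciSup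
      (show _ < ⨆ h : H, |labelSum ε fun i => (h : X → Bool) (x i)| from hx)
    refine ⟨h, hh, ?_⟩
    rw [Function.comp_assoc, labelSum_ghostWeight_inl, Function.comp_assoc, meanSum_ghostWeight_inr]
    exact mul_sub_le_abs_ghost_sum (blockTilt_nonneg hs0 hst h1) (blockTilt_le_markTilt hs0 hst h1)
      (Nat.cast_nonneg _) hn (abs_meanSum_le_meanSup ε Q hh) hS.le
  have hexp : ∫⁻ z, ENNReal.ofReal (Real.exp (labelSup H w z))
      ∂Measure.pi (fun j => P (ghostEquiv ι κ j)) ≤ _ :=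
    (lintegral_exp_labelSup_comp_equiv H _ P _).trans_le
      (lintegral_exp_labelSup_ghostWeight_le hVC hreg (cosh_markTilt_add_mul_sinh_le hsI htI) hε
        hsum Q hQ fun _ => none)
  refine (measure_mono hghost).trans ((measure_exists_le_abs_labelSum_add_meanSum_le hH w
    (fun j => P (ghostEquiv ι κ j)) (hreg.aemeasurable_labelSup _ (fun j => hQ _) w) c).trans
      ((ENNReal.div_le_div_right hexp _).trans_eq ?_))
  rw [← ENNReal.ofReal_div_of_pos (Real.exp_pos c), div_eq_mul_inv, ← Real.exp_neg, mul_assoc, hc,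
    ← mul_neg, Real.exp_nat_mul, ← mul_pow, tiltBound_mul_exp hsI htI, ← Real.exp_nat_mul, mul_neg,
    Fintype.card_option]

end Ghosts

section LowerTail

variable {X J : Type*} [MeasurableSpace X] [Fintype J]

theorem hasSubgaussianMGF_const_mul_label (P : J → Measure X) [∀ j, IsProbabilityMeasure (P j)]
    {h : X → Bool} (hh : Measurable h) (r : ℝ) (j : J) :
    HasSubgaussianMGF (fun z : J → X =>
        r * ((if h (z j) = true then (1 : ℝ) else 0) - (P j).real (h ⁻¹' {true})))
      (‖r‖₊ ^ 2 / 4) (Measure.pi P) := by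
  have hsub := hasSubgaussianMGF_of_mem_Icc (a := 0) (b := 1) (μ := Measure.pi P)
    ((measurable_label hh).comp (measurable_pi_apply j)).aemeasurable
    (.of_forall fun z => by simp only [Function.comp_apply]; split_ifs <;> simp)
  have hmean := integral_comp_eval (μ := P) (i := j) (measurable_label hh).aestronglyMeasurable
  rw [integral_label hh] at hmean
  simp only [Function.comp_apply, hmean] at hsub
  convert hsub.const_mul r using 1
  ext
  change ‖r‖ ^ 2 / 4 = r ^ 2 * (‖(1 : ℝ) - 0‖ / 2) ^ 2
  norm_num
  ring

theorem measureReal_labelSum_add_le_meanSum_le (w : J → ℝ) (P : J → Measure X)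
    [∀ j, IsProbabilityMeasure (P j)] {h : X → Bool} (hh : Measurable h) {s : ℝ} (hs : 0 ≤ s) :
    (Measure.pi P).real {z | labelSum w (fun j => h (z j)) + s ≤ meanSum w P h} ≤
      Real.exp (-(2 * s ^ 2 / ∑ j, w j ^ 2)) := by
  let Y (j : J) (x : X) : ℝ :=
    -w j * ((if h x = true then 1 else 0) - (P j).real (h ⁻¹' {true}))
  have hindep : iIndepFun (fun j (z : J → X) => Y j (z j)) (Measure.pi P) :=
    iIndepFun_pi fun j => (((measurable_label hh).sub_const _).const_mul (-w j)).aemeasurable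
  have hsum (z : J → X) : ∑ j, Y j (z j) = meanSum w P h - labelSum w fun j => h (z j) := by
    rw [meanSum, labelSum, ← Finset.sum_sub_distrib]
    exact Finset.sum_congr rfl fun j _ => by ring
  have hset : {z : J → X | labelSum w (fun j => h (z j)) + s ≤ meanSum w P h} =
      {z | s ≤ ∑ j, Y j (z j)} := by
    ext z
    rw [Set.mem_ofPred_eq, Set.mem_ofPred_eq, hsum, le_sub_iff_add_le']
  rw [hset]
  refine (HasSubgaussianMGF.measure_sum_ge_le_of_iIndepFun hindep
    (fun j _ => hasSubgaussianMGF_const_mul_label P hh (-w j) j) hs).trans_eq ?_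
  push_cast
  simp only [norm_neg, Real.norm_eq_abs, sq_abs, ← Finset.sum_div]
  congr 1
  field_simp
  norm_num

theorem measure_labelSup_add_le_abs_meanSum_le {ε : J → ℝ} (hε : ∀ j, ε j = 1 ∨ ε j = -1)
    (P : J → Measure X) [∀ j, IsProbabilityMeasure (P j)] {H : Set (X → Bool)} {h : X → Bool}
    (hh : h ∈ H) (hhm : Measurable h) {s : ℝ} (hs : 0 ≤ s) :
    Measure.pi P {x | labelSup H ε x + s ≤ |meanSum ε P h|} ≤
      ENNReal.ofReal (Real.exp (-(2 * s ^ 2 / Fintype.card J))) := by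
  suffices hsigned : ∀ w : J → ℝ, (∀ j, w j ^ 2 = 1) → |meanSum ε P h| = meanSum w P h →
      (∀ p, labelSum w p ≤ |labelSum ε p|) →
      Measure.pi P {x | labelSup H ε x + s ≤ |meanSum ε P h|} ≤
        ENNReal.ofReal (Real.exp (-(2 * s ^ 2 / Fintype.card J))) by
    have hsq (j : J) : ε j ^ 2 = 1 := sq_eq_one_iff.2 (hε j)
    rcases abs_choice (meanSum ε P h) with hpos | hneg
    · exact hsigned ε hsq hpos fun p => le_abs_self _
    · refine hsigned (-ε) (by simpa using hsq) (by simpa [meanSum] using hneg) fun p => ?_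
      simp only [labelSum, Pi.neg_apply, neg_mul, Finset.sum_neg_distrib]
      exact neg_le_abs _
  intro w hsq hmean hle
  have hcard : ∑ j, w j ^ 2 = Fintype.card J := by simp [hsq]
  calc Measure.pi P {x | labelSup H ε x + s ≤ |meanSum ε P h|}
      ≤ Measure.pi P {x | labelSum w (fun j => h (x j)) + s ≤ meanSum w P h} := by
        refine measure_mono fun x hx => ?_
        rw [Set.mem_ofPred_eq, hmean] at hx
        refine le_trans ?_ hx
        gcongr
        exact (hle _).trans (abs_labelSum_le_labelSup ε x hh)
    _ ≤ ENNReal.ofReal (Real.exp (-(2 * s ^ 2 / Fintype.card J))) := by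
        rw [← ofReal_measureReal, ← hcard]
        exact ENNReal.ofReal_le_ofReal (measureReal_labelSum_add_le_meanSum_le _ P hhm hs)

end LowerTail

section TwoSided

variable {X ι : Type*} [MeasurableSpace X] [Fintype ι] {ε : ι → ℝ} {H : Set (X → Bool)}

theorem measure_labelSup_add_lt_meanSup_le (hne : H.Nonempty) (hH : ∀ h ∈ H, Measurable h)
    (hε : ∀ i, ε i = 1 ∨ ε i = -1) (Q : ι → Measure X) [∀ i, IsProbabilityMeasure (Q i)] {s : ℝ}
    (hs : 0 < s) :
    Measure.pi Q {x | labelSup H ε x + s < meanSup H ε Q} ≤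
      ENNReal.ofReal (Real.exp (-(2 * s ^ 2 / Fintype.card ι))) := by
  have := hne.to_subtype
  have hcont : Continuous fun r : ℝ =>
      ENNReal.ofReal (Real.exp (-(2 * r ^ 2 / Fintype.card ι))) :=
    ENNReal.continuous_ofReal.comp (by fun_prop)
  refine ge_of_tendsto ((hcont.tendsto s).mono_left (nhdsWithin_le_nhds (s := Set.Iio s))) ?_
  filter_upwards [Ioo_mem_nhdsLT hs] with r ⟨hr0, hrs⟩
  obtain ⟨⟨h, hh⟩, hmean⟩ := exists_lt_of_lt_ciSup
    (show meanSup H ε Q - (s - r) < ⨆ h : H, |meanSum ε Q h| from sub_lt_self _ (sub_pos.2 hrs))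
  refine (measure_mono fun x hx => ?_).trans
    (measure_labelSup_add_le_abs_meanSum_le hε Q hh (hH h hh) hr0.le)
  rw [Set.mem_ofPred_eq] at hx ⊢
  linarith

theorem measure_lt_abs_meanSup_sub_labelSup_le {m d : ℕ} (hι : Fintype.card ι = 2 * m)
    (hm : 0 < m) (hdm : d ≤ m) {t c : ℝ} (h0 : 0 < t) (h1 : t < 1) (hc : 0 ≤ c)
    (ht : m * t ^ 2 / 2 = c + d * Real.log (Real.exp 1 * m / d)) (hH : ∀ h ∈ H, Measurable h)
    (hVC : HasVCDim H d) {D : Set (Measure X)} (hreg : IsMeasurableClass H D)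
    (hε : ∀ i, ε i = 1 ∨ ε i = -1) (hsum : ∑ i, ε i = 0) (Q : ι → Measure X)
    [∀ i, IsProbabilityMeasure (Q i)] (hQ : ∀ i, Q i ∈ D) :
    Measure.pi Q {x | m * t < |meanSup H ε Q - labelSup H ε x|} ≤
      ENNReal.ofReal (3 * Real.exp (-c)) := by
  have hlog := mul_log_exp_one_mul_div_nonneg hdm
  have hm0 : (0 : ℝ) < m := mod_cast hm
  have hupper : Measure.pi Q {x | meanSup H ε Q + m * t < labelSup H ε x} ≤
      ENNReal.ofReal (2 * Real.exp (-c)) := by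
    have htail := measure_meanSup_add_lt_labelSup_le (Fin 11) hH hVC hreg hε hsum Q hQ h0.le h1
    have hnum := two_mul_sum_choose_mul_exp_le hdm h0 h1 hc ht
    norm_num [hι] at htail hnum
    exact htail.trans (ENNReal.ofReal_le_ofReal hnum)
  have hlower : Measure.pi Q {x | labelSup H ε x + m * t < meanSup H ε Q} ≤
      ENNReal.ofReal (Real.exp (-c)) := by
    refine (measure_labelSup_add_lt_meanSup_le hVC.nonempty hH hε Q (by positivity)).trans
      (ENNReal.ofReal_le_ofReal (Real.exp_le_exp.2 (neg_le_neg ?_)))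
    rw [hι, show 2 * (m * t) ^ 2 / ((2 * m : ℕ) : ℝ) = m * t ^ 2 by push_cast; field_simp]
    nlinarith [mul_pos hm0 (sq_pos_of_pos h0)]
  calc Measure.pi Q {x | m * t < |meanSup H ε Q - labelSup H ε x|}
      ≤ Measure.pi Q ({x | meanSup H ε Q + m * t < labelSup H ε x} ∪
          {x | labelSup H ε x + m * t < meanSup H ε Q}) := by
        refine measure_mono fun x hx => ?_
        rw [Set.mem_ofPred_eq, lt_abs, neg_sub, lt_sub_iff_add_lt', lt_sub_iff_add_lt'] at hx
        exact hx.symm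
    _ ≤ ENNReal.ofReal (2 * Real.exp (-c)) + ENNReal.ofReal (Real.exp (-c)) :=
        (measure_union_le _ _).trans (add_le_add hupper hlower)
    _ = ENNReal.ofReal (3 * Real.exp (-c)) := by
        rw [← ENNReal.ofReal_add (by positivity) (by positivity)]
        ring_nf

end TwoSided

section Divergence

variable {X : Type*} [MeasurableSpace X] {H : Set (X → Bool)} {m : ℕ}

theorem hDivergence_eq_mul_iSup {P Q : Measure X} {r : ℝ} (hr : 0 ≤ r) {f : (X → Bool) → ℝ}
    (hf : ∀ h ∈ H, P.real (h ⁻¹' {true}) - Q.real (h ⁻¹' {true}) = r * f h) :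
    hDivergence H P Q = 2 * (r * ⨆ h : H, |f h|) := by
  let g : H → hypothesisSets H := fun h => ⟨(h : X → Bool) ⁻¹' {true}, h, h.2, rfl⟩
  have hg : Function.Surjective g := by
    rintro ⟨_, h, hh, rfl⟩
    exact ⟨⟨h, hh⟩, rfl⟩
  rw [hDivergence, ← hg.iSup_comp, Real.mul_iSup_of_nonneg hr]
  congr 2
  funext h
  rw [hf h h.2, abs_mul, abs_of_nonneg hr]

theorem hDivergence_mem_Icc (H : Set (X → Bool)) (P Q : Measure X) [IsProbabilityMeasure P]
    [IsProbabilityMeasure Q] : hDivergence H P Q ∈ Set.Icc 0 2 := by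
  refine ⟨mul_nonneg zero_le_two (Real.iSup_nonneg fun A => abs_nonneg _), ?_⟩
  have hsup : ⨆ A : hypothesisSets H, |P.real (A : Set X) - Q.real (A : Set X)| ≤ 1 :=
    Real.iSup_le (fun A => abs_sub_le_of_nonneg_of_le measureReal_nonneg measureReal_le_one
      measureReal_nonneg measureReal_le_one) zero_le_one
  rw [hDivergence]
  linarith

theorem isProbabilityMeasure_empiricalMeasure (hm : 0 < m) (x : Fin m → X) :
    IsProbabilityMeasure (empiricalMeasure x) := by
  constructor
  simp [empiricalMeasure, ENNReal.inv_mul_cancel, hm.ne']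

theorem empiricalMeasure_real (x : Fin m → X) {h : X → Bool} (hh : Measurable h) :
    (empiricalMeasure x).real (h ⁻¹' {true}) =
      (m : ℝ)⁻¹ * ∑ j, if h (x j) = true then 1 else 0 := by
  rw [← integral_label hh, empiricalMeasure, integral_smul_measure, integral_finsetSum_measure]
  · simp [integral_dirac' _ _ (measurable_label hh).stronglyMeasurable]
  · exact fun j _ => .of_bound (measurable_label hh).aestronglyMeasurable 1
      (.of_forall fun x => by split_ifs <;> simp)

/-- The signs of the points of the two samples of size `m`, under which the weighted number of
positive labels is the difference of the two numbers of positive labels. -/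
def twoSampleSign (m : ℕ) : Fin m ⊕ Fin m → ℝ := Sum.elim 1 (-1)

/-- The laws of the points of a sample from `P` and a sample from `Q`, both of size `m`. -/
noncomputable def twoSampleLaw (m : ℕ) (P Q : Measure X) : Fin m ⊕ Fin m → Measure X :=
  Sum.elim (fun _ => P) fun _ => Q

instance (P Q : Measure X) [IsProbabilityMeasure P] [IsProbabilityMeasure Q]
    (j : Fin m ⊕ Fin m) : IsProbabilityMeasure (twoSampleLaw m P Q j) := by
  cases j <;> assumption

theorem hDivergence_eq_meanSup (hm : 0 < m) (P Q : Measure X) :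
    hDivergence H P Q = 2 * ((m : ℝ)⁻¹ * meanSup H (twoSampleSign m) (twoSampleLaw m P Q)) := by
  refine hDivergence_eq_mul_iSup (by positivity) fun h _ => ?_
  have hsum : meanSum (twoSampleSign m) (twoSampleLaw m P Q) h =
      m * (P.real (h ⁻¹' {true}) - Q.real (h ⁻¹' {true})) := by
    simp only [meanSum, Fintype.sum_sum_type, twoSampleSign, twoSampleLaw, Sum.elim_inl,
      Sum.elim_inr, Pi.one_apply, Pi.neg_apply, Finset.sum_const, Finset.card_univ,
      Fintype.card_fin, nsmul_eq_mul]
    ring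
  rw [hsum, inv_mul_cancel_left₀ (mod_cast hm.ne')]

theorem hDivergence_empiricalMeasure (hH : ∀ h ∈ H, Measurable h) (x y : Fin m → X) :
    hDivergence H (empiricalMeasure x) (empiricalMeasure y) =
      2 * ((m : ℝ)⁻¹ * labelSup H (twoSampleSign m) (Sum.elim x y)) := by
  refine hDivergence_eq_mul_iSup (f := fun h => labelSum _ fun j => h (Sum.elim x y j))
    (by positivity) fun h hh => ?_
  rw [empiricalMeasure_real x (hH h hh), empiricalMeasure_real y (hH h hh), ← mul_sub, labelSum,
    Fintype.sum_sum_type]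
  simp only [twoSampleSign, Sum.elim_inl, Sum.elim_inr, Pi.one_apply, Pi.neg_apply, one_mul,
    neg_one_mul, Finset.sum_neg_distrib, sub_eq_add_neg]
  rfl

end Divergence

theorem abs_iSup_sub_iSup_le {ι : Type*} [Finite ι] [Nonempty ι] {f g : ι → ℝ} {c : ℝ}
    (h : ∀ i, |f i - g i| ≤ c) : |(⨆ i, f i) - ⨆ i, g i| ≤ c := by
  have hle {f g : ι → ℝ} (hfg : ∀ i, f i - g i ≤ c) : (⨆ i, f i) - ⨆ i, g i ≤ c :=
    sub_le_iff_le_add'.2 (ciSup_le fun i => (sub_le_iff_le_add'.1 (hfg i)).trans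
      (add_le_add_left (le_ciSup (Set.finite_range g).bddAbove i) c))
  exact abs_sub_le_iff.2 ⟨hle fun i => (abs_sub_le_iff.1 (h i)).1,
    hle fun i => (abs_sub_le_iff.1 (h i)).2⟩

section Samples

variable {X Ω : Type*} [MeasurableSpace X] [MeasurableSpace Ω] {μ : Measure Ω}
  {H : Set (X → Bool)} {m : ℕ} {P Q : Measure X} {D : Set (Measure X)}
  {x y : Fin m → Ω → X}

theorem hasLaw_twoSample [IsProbabilityMeasure P] [IsProbabilityMeasure Q]
    (hx : ∀ j, HasLaw (x j) P μ) (hy : ∀ j, HasLaw (y j) Q μ)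
    (hindep : iIndepFun (Sum.elim x y) μ) :
    HasLaw (fun ω => Sum.elim (fun j => x j ω) fun j => y j ω)
      (Measure.pi (twoSampleLaw m P Q)) μ := by
  have hlaw : ∀ j, HasLaw (Sum.elim x y j) (twoSampleLaw m P Q j) μ := Sum.rec hx hy
  convert hindep.hasLaw_pi hlaw using 3 with ω j
  cases j <;> rfl

theorem twoSampleLaw_mem (hP : P ∈ D) (hQ : Q ∈ D) (j : Fin m ⊕ Fin m) :
    twoSampleLaw m P Q j ∈ D := by
  cases j <;> assumption

theorem IsMeasurableClass.aemeasurable_hDivergence_empiricalMeasure (hreg : IsMeasurableClass H D)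
    (hH : ∀ h ∈ H, Measurable h) [IsProbabilityMeasure P] [IsProbabilityMeasure Q] (hP : P ∈ D)
    (hQ : Q ∈ D) (hx : ∀ j, HasLaw (x j) P μ) (hy : ∀ j, HasLaw (y j) Q μ)
    (hindep : iIndepFun (Sum.elim x y) μ) :
    AEMeasurable (fun ω => hDivergence H (empiricalMeasure fun j => x j ω)
      (empiricalMeasure fun j => y j ω)) μ := by
  have hlaw := hasLaw_twoSample hx hy hindep
  have hsup := hreg.aemeasurable_labelSup _ (twoSampleLaw_mem hP hQ) (twoSampleSign m)
  rw [← hlaw.map_eq] at hsup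
  simp only [hDivergence_empiricalMeasure hH]
  exact ((hsup.comp_aemeasurable hlaw.aemeasurable).const_mul _).const_mul _

theorem abs_hDivergence_sub_empiricalMeasure_le (hm : 0 < m) [IsProbabilityMeasure P]
    [IsProbabilityMeasure Q] (x y : Fin m → X) :
    |hDivergence H P Q - hDivergence H (empiricalMeasure x) (empiricalMeasure y)| ≤ 2 := by
  have := isProbabilityMeasure_empiricalMeasure hm x
  have := isProbabilityMeasure_empiricalMeasure hm y
  have hpop := hDivergence_mem_Icc H P Q
  have hemp := hDivergence_mem_Icc H (empiricalMeasure x) (empiricalMeasure y)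
  exact abs_sub_le_of_nonneg_of_le hpop.1 hpop.2 hemp.1 hemp.2

theorem measure_lt_abs_hDivergence_sub_empiricalMeasure_le {d : ℕ} (hm : 0 < m) (hdm : d ≤ m)
    {c : ℝ} (hc : 0 < c) (hH : ∀ h ∈ H, Measurable h) (hVC : HasVCDim H d)
    (hreg : IsMeasurableClass H D) [IsProbabilityMeasure P] [IsProbabilityMeasure Q] (hP : P ∈ D)
    (hQ : Q ∈ D) (hx : ∀ j, HasLaw (x j) P μ) (hy : ∀ j, HasLaw (y j) Q μ)
    (hindep : iIndepFun (Sum.elim x y) μ) :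
    μ {ω | 2 * √(2 / m * (c + d * Real.log (Real.exp 1 * m / d))) <
        |hDivergence H P Q - hDivergence H (empiricalMeasure fun j => x j ω)
          (empiricalMeasure fun j => y j ω)|} ≤ ENNReal.ofReal (3 * Real.exp (-c)) := by
  have hlog := mul_log_exp_one_mul_div_nonneg hdm
  have hm0 : (0 : ℝ) < m := mod_cast hm
  set t := √(2 / m * (c + d * Real.log (Real.exp 1 * m / d))) with ht
  rcases le_or_gt 1 t with h1 | h1
  · refine (measure_mono_null (fun ω hω => ?_) measure_empty).trans_le zero_le
    rw [Set.mem_ofPred_eq] at hω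
    exact absurd (abs_hDivergence_sub_empiricalMeasure_le hm _ _) (by linarith)
  have ht0 : 0 < t := Real.sqrt_pos.2 (by positivity)
  have ht2 : m * t ^ 2 / 2 = c + d * Real.log (Real.exp 1 * m / d) := by
    rw [ht, Real.sq_sqrt (by positivity)]
    field_simp
  have hlaw := hasLaw_twoSample hx hy hindep
  have hdev := measure_lt_abs_meanSup_sub_labelSup_le (ε := twoSampleSign m) (by simp [two_mul]) hm
    hdm ht0 h1 hc.le ht2 hH hVC hreg (Sum.rec (fun _ => .inl rfl) fun _ => .inr rfl)
    (by simp [twoSampleSign]) _ (twoSampleLaw_mem hP hQ)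
  rw [← hlaw.map_eq] at hdev
  refine (measure_mono fun ω hω => ?_).trans ((Measure.le_map_apply hlaw.aemeasurable _).trans hdev)
  rw [Set.mem_ofPred_eq, hDivergence_eq_meanSup hm, hDivergence_empiricalMeasure hH, ← mul_sub,
    ← mul_sub, abs_mul, abs_mul, abs_two, abs_of_pos (inv_pos.2 hm0), mul_lt_mul_iff_right₀ two_pos,
    lt_inv_mul_iff₀ hm0] at hω
  exact hω

theorem IsMeasurableClass.aemeasurable_multiHDivergence_empiricalMeasure {k : ℕ}
    {Q : Fin k → Measure X} {y : Fin k → Fin m → Ω → X} (hreg : IsMeasurableClass H D)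
    (hH : ∀ h ∈ H, Measurable h) [IsProbabilityMeasure P] [∀ i, IsProbabilityMeasure (Q i)]
    (hP : P ∈ D) (hQ : ∀ i, Q i ∈ D) (hx : ∀ j, HasLaw (x j) P μ)
    (hy : ∀ i j, HasLaw (y i j) (Q i) μ) (hindep : ∀ i, iIndepFun (Sum.elim x (y i)) μ) :
    AEMeasurable (fun ω => multiHDivergence H (empiricalMeasure fun j => x j ω)
      fun i => empiricalMeasure fun j => y i j ω) μ :=
  AEMeasurable.iSup fun i =>
    hreg.aemeasurable_hDivergence_empiricalMeasure hH hP (hQ i) hx (hy i) (hindep i)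

theorem measure_lt_abs_multiHDivergence_sub_empiricalMeasure_le {k d : ℕ} (hk : 0 < k)
    (hm : 0 < m) (hdm : d ≤ m) {c : ℝ} (hc : 0 < c) {Q : Fin k → Measure X}
    {y : Fin k → Fin m → Ω → X} (hH : ∀ h ∈ H, Measurable h) (hVC : HasVCDim H d)
    (hreg : IsMeasurableClass H D) [IsProbabilityMeasure P] [∀ i, IsProbabilityMeasure (Q i)]
    (hP : P ∈ D) (hQ : ∀ i, Q i ∈ D) (hx : ∀ j, HasLaw (x j) P μ)
    (hy : ∀ i j, HasLaw (y i j) (Q i) μ) (hindep : ∀ i, iIndepFun (Sum.elim x (y i)) μ) :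
    μ {ω | 2 * √(2 / m * (c + d * Real.log (Real.exp 1 * m / d))) <
        |multiHDivergence H P Q - multiHDivergence H (empiricalMeasure fun j => x j ω)
          fun i => empiricalMeasure fun j => y i j ω|} ≤
      ENNReal.ofReal (k * (3 * Real.exp (-c))) := by
  have : Nonempty (Fin k) := ⟨⟨0, hk⟩⟩
  set r := 2 * √(2 / m * (c + d * Real.log (Real.exp 1 * m / d)))
  calc _ ≤ μ (⋃ i, {ω | r < |hDivergence H P (Q i) - hDivergence H
          (empiricalMeasure fun j => x j ω) (empiricalMeasure fun j => y i j ω)|}) := by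
        refine measure_mono fun ω hω => ?_
        contrapose! hω
        simp only [Set.mem_iUnion, Set.mem_ofPred_eq, not_exists, not_lt] at hω ⊢
        exact abs_iSup_sub_iSup_le hω
    _ ≤ ∑ _i : Fin k, ENNReal.ofReal (3 * Real.exp (-c)) :=
        (measure_iUnion_fintype_le _ _).trans (Finset.sum_le_sum fun i _ =>
          measure_lt_abs_hDivergence_sub_empiricalMeasure_le hm hdm hc hH hVC hreg hP (hQ i) hx
            (hy i) (hindep i))
    _ = ENNReal.ofReal (k * (3 * Real.exp (-c))) := by
        rw [Finset.sum_const, Finset.card_univ, Fintype.card_fin, nsmul_eq_mul,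
          ← ENNReal.ofReal_natCast, ← ENNReal.ofReal_mul k.cast_nonneg]

theorem iIndepFun_sumElim_of_prod {k : ℕ} {y : Fin k → Fin m → Ω → X}
    (hindep : iIndepFun (Sum.elim x fun p : Fin k × Fin m => y p.1 p.2) μ) (i : Fin k) :
    iIndepFun (Sum.elim x (y i)) μ := by
  have hpair := hindep.precomp (g := Sum.map id (Prod.mk i))
    (Function.injective_id.sumMap (Prod.mk_right_injective i))
  convert hpair with j
  cases j <;> rfl

end Samples

theorem mainTheorem5_general {X Ω : Type*} [MeasurableSpace X] [MeasurableSpace Ω]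
    (μ : Measure Ω) [IsProbabilityMeasure μ]
    (k m d : ℕ) (hk : 0 < k) (hm : 0 < m) (hdm : d ≤ m)
    (DT : Measure X) [IsProbabilityMeasure DT]
    (DS : Fin k → Measure X) [∀ i, IsProbabilityMeasure (DS i)]
    (H : Set (X → Bool)) (hH : ∀ h ∈ H, Measurable h)
    (hreg : IsMeasurableClass H (insert DT (Set.range DS)))
    (hVC : HasVCDim H d)
    (xT : Fin m → Ω → X) (xS : Fin k → Fin m → Ω → X)
    (hxT : ∀ j, HasLaw (xT j) DT μ)
    (hxS : ∀ i j, HasLaw (xS i j) (DS i) μ)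
    (hindep : ∀ i, iIndepFun (Sum.elim xT (xS i)) μ)
    (δ : ℝ) (hδ0 : 0 < δ) (hδ1 : δ < 1) :
    NullMeasurableSet
        {ω | |multiHDivergence H DT DS -
              multiHDivergence H (empiricalMeasure fun j => xT j ω)
                (fun i => empiricalMeasure fun j => xS i j ω)| ≤
            2 * Real.sqrt ((2 / (m : ℝ)) *
              (Real.log (4 * k / δ) + d * Real.log (Real.exp 1 * m / d)))} μ ∧
      1 - δ ≤ μ.real
        {ω | |multiHDivergence H DT DS -
              multiHDivergence H (empiricalMeasure fun j => xT j ω)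
                (fun i => empiricalMeasure fun j => xS i j ω)| ≤
            2 * Real.sqrt ((2 / (m : ℝ)) *
              (Real.log (4 * k / δ) + d * Real.log (Real.exp 1 * m / d)))} := by
  have hmem (i : Fin k) : DS i ∈ insert DT (Set.range DS) := .inr ⟨i, rfl⟩
  have hemp := hreg.aemeasurable_multiHDivergence_empiricalMeasure hH (.inl rfl) hmem hxT hxS hindep
  have hA := nullMeasurableSet_le (hemp.const_sub (multiHDivergence H DT DS)).abs
    (aemeasurable_const (b := 2 * √(2 / m *
      (Real.log (4 * k / δ) + d * Real.log (Real.exp 1 * m / d)))))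
  have hk1 : (1 : ℝ) ≤ k := mod_cast hk
  have hlog : 0 < Real.log (4 * k / δ) := Real.log_pos (by rw [one_lt_div hδ0]; linarith)
  have hbad := measure_lt_abs_multiHDivergence_sub_empiricalMeasure_le hk hm hdm hlog hH hVC hreg
    (.inl rfl) hmem hxT hxS hindep
  have hprob : k * (3 * Real.exp (-Real.log (4 * k / δ))) = 3 / 4 * δ := by
    rw [Real.exp_neg, Real.exp_log (by positivity)]
    field_simp
  have hreal := ENNReal.toReal_le_of_le_ofReal (by positivity) (hprob ▸ hbad)
  have hcompl := probReal_compl_eq_one_sub₀ hA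
  simp only [Set.compl_ofPred, not_le] at hcompl
  refine ⟨hA, ?_⟩
  rw [← measureReal_def] at hreal
  linarith

theorem mainTheorem5 {X Ω : Type*} [MeasurableSpace X] [MeasurableSpace Ω]
    (μ : Measure Ω) [IsProbabilityMeasure μ]
    (k m d : ℕ) (hk : 0 < k) (hm : 0 < m) (hdm : d ≤ m)
    (DT : Measure X) [IsProbabilityMeasure DT]
    (DS : Fin k → Measure X) [∀ i, IsProbabilityMeasure (DS i)]
    (H : Set (X → Bool)) (hH : ∀ h ∈ H, Measurable h)
    (hreg : IsMeasurableClass H (insert DT (Set.range DS)))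
    (hVC : HasVCDim H d)
    (xT : Fin m → Ω → X) (xS : Fin k → Fin m → Ω → X)
    (hxT : ∀ j, HasLaw (xT j) DT μ)
    (hxS : ∀ i j, HasLaw (xS i j) (DS i) μ)
    (hindep : iIndepFun (Sum.elim xT fun p : Fin k × Fin m => xS p.1 p.2) μ)
    (δ : ℝ) (hδ0 : 0 < δ) (hδ1 : δ < 1) :
    NullMeasurableSet
        {ω | |multiHDivergence H DT DS -
              multiHDivergence H (empiricalMeasure fun j => xT j ω)
                (fun i => empiricalMeasure fun j => xS i j ω)| ≤
            2 * Real.sqrt ((2 / (m : ℝ)) *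
              (Real.log (4 * k / δ) + d * Real.log (Real.exp 1 * m / d)))} μ ∧
      1 - δ ≤ μ.real
        {ω | |multiHDivergence H DT DS -
              multiHDivergence H (empiricalMeasure fun j => xT j ω)
                (fun i => empiricalMeasure fun j => xS i j ω)| ≤
            2 * Real.sqrt ((2 / (m : ℝ)) *
              (Real.log (4 * k / δ) + d * Real.log (Real.exp 1 * m / d)))} :=
  mainTheorem5_general μ k m d hk hm hdm DT DS H hH hreg hVC xT xS hxT hxS
    (iIndepFun_sumElim_of_prod hindep) δ hδ0 hδ1
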